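/- Let $p$ be a prime, $F=\mathbb F_p$, $\bar F$ an algebraic closure of $F$ and $G$ a finite group. For a field $K$, all $KG$-modules are finitely generated; $\mathrm{ITS}(KG)$ denotes the set of isomorphism types of simple $KG$-modules, and $U\mid V$ means that $U$ is isomorphic to a direct summand of $V$. For an $FG$-module $W$ let $\mathcal E(W)$ be the class of all pairs $(K,V)$ where $K$ is a finite subfield of $\bar F$ and $V$ is an indecomposable $KG$-module with $V\mid W\otimes_F K$. For an indecomposable $KG$-module $V$, a vertex of $V$ is a subgroup $Q\le G$ that is minimal subject to $V\mid \mathrm{Ind}_Q^G(\mathrm{Res}^G_Q V)$; a vertex-source pair of $V$ is a pair $(Q,\mathscr V)$ where $Q$ is a vertex of $V$ and $\mathscr V$ is an indecomposable $KQ$-module with $V\mid\mathrm{Ind}_Q^G(\mathscr V)$. If $V$ has vertex $Q$ and $H=N_G(Q)$, then $\mathrm{Gr}_G^H(V)$ denotes the Green correspondent of $V$, i.e. an indecomposable component of $\mathrm{Res}^G_H V$ with vertex $Q$. **Theorem.** (a) There is a well-defined map $\Sigma:\mathrm{ITS}(\bar FG)\to\mathrm{ITS}(FG)$ such that, for all simple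 $\bar FG$-modules $X$ and simple $FG$-modules $W$, $\Sigma(X)=W$ if and only if there is $(K,V)\in\mathcal E(W)$ with $V\otimes_K\bar F\cong X$ as $\bar FG$-modules. Moreover, whenever $X\in \mathrm{ITS}(\bar FG)$, $W\in\mathrm{ITS}(FG)$ and $(K,V)\in\mathcal E(W)$ satisfy $V\otimes_K\bar F\cong X$, the $KG$-module $V$ is simple, and for every vertex $Q$ of $W$, with $H=N_G(Q)$: - $Q$ is a vertex of $V$ and of $X$; - if $(Q,\mathscr V)$ and $(Q,\mathscr Y)$ are vertex-source pairs of $V$ and $X$ respectively, then $\mathscr Y^h\mid\mathscr V\otimes_K\bar F$ as $\bar FQ$-modules for some $h\in H$; - Green correspondents $\mathrm{Gr}_G^H(V)$ and $\mathrm{Gr}_G^H(X)$ exist, and any such satisfy $\mathrm{Gr}_G^H(X)\mid\mathrm{Gr}_G^H(V)\otimes_K\bar F$ as $\bar FH$-modules. (b) $\Sigma^{-1}(W)\neq\varnothing$ for all $W\in\mathrm{ITS}(FG)$. (c) $\mathrm{ITS}(\bar FG)=\bigcup_{W\in\mathrm{ITS}(FG)}\Sigma^{-1}(W)$ is a partition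 of $\mathrm{ITS}(\bar FG)$ (the fibers over distinct $W$ are disjoint). In particular, $\mathrm{ITS}(\bar FG)$ and $\mathrm{ITS}(FG)$ are finite and the number of isomorphism types of simple $\bar FG$-modules, that is, of absolutely simple modules over $\bar F$, is $$|\mathrm{ITS}(\bar FG)|=\sum_{W\in\mathrm{ITS}(FG)}|\Sigma^{-1}(W)|.$$ -/

import Mathlib

open scoped TensorProduct

universe u v w w'

namespace GreenTheory

/-! `KG`-modules are `K`-linear representations of `G`. -/

section Basic

variable {K : Type u} [Field K] {G : Type v} [Group G]
  {V : Type w} [AddCommGroup V] [Module K V] {U : Type w'} [AddCommGroup U] [Module K U]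

/-- `U ∣ V`: the module `U` is isomorphic to a direct summand of `V`. -/
def IsSummand (σ : Representation K G U) (ρ : Representation K G V) : Prop :=
  ∃ A B : Subrepresentation ρ, IsCompl A B ∧ Nonempty (σ.Equiv A.toRepresentation)

/-- `V` is a finitely generated indecomposable module: it is finite dimensional, nonzero, and in
every decomposition `V = A ⊕ B` one of the two summands is zero. -/
def IsIndecomposable (ρ : Representation K G V) : Prop :=
  FiniteDimensional K V ∧ Nontrivial V ∧
    ∀ A B : Subrepresentation ρ, IsCompl A B → A = ⊥ ∨ B = ⊥

/-- Extension of scalars: the `LG`-module `L ⊗[K] V`, on which `G` acts through `V`. -/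
def baseChange (L : Type w') [Field L] [Algebra K L] (ρ : Representation K G V) :
    Representation L G (L ⊗[K] V) where
  toFun g := (ρ g).baseChange L
  map_one' := by
    rw [map_one]
    exact LinearMap.baseChange_one K V
  map_mul' g h := by
    rw [map_mul]
    exact LinearMap.baseChange_mul (ρ g) (ρ h)

/-- Restriction to a subgroup. -/
abbrev res (Q : Subgroup G) (ρ : Representation K G V) : Representation K Q V :=
  ρ.comp Q.subtype

/-- Induction from a subgroup. -/
noncomputable abbrev ind (Q : Subgroup G) (σ : Representation K Q V) :
    Representation K G (Representation.IndV Q.subtype σ) :=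
  Representation.ind Q.subtype σ

/-- `V` is (relatively) `Q`-projective: `V` is a direct summand of the module induced from its own
restriction to `Q`. -/
def IsRelProjective (Q : Subgroup G) (ρ : Representation K G V) : Prop :=
  IsSummand ρ (ind Q (res Q ρ))

/-- `Q` is a vertex of the indecomposable module `V`: `Q` is minimal among the subgroups relative
to which `V` is projective. -/
def IsVertex (Q : Subgroup G) (ρ : Representation K G V) : Prop :=
  IsIndecomposable ρ ∧ Minimal (fun P : Subgroup G => IsRelProjective P ρ) Q

/-- `(Q, σ)` is a vertex-source pair of `V`: `Q` is a vertex of `V` and `σ` is an indecomposable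
`KQ`-module such that `V` is a direct summand of the module induced from `σ`. -/
def IsVertexSource (Q : Subgroup G) (σ : Representation K Q U) (ρ : Representation K G V) : Prop :=
  IsVertex Q ρ ∧ IsIndecomposable σ ∧ IsSummand ρ (ind Q σ)

/-- The normalizer `N_G(Q)`. -/
abbrev normalizer (Q : Subgroup G) : Subgroup G := Subgroup.normalizer (Q : Set G)

/-- The conjugate of a `KQ`-module by `h ∈ N_G(Q)`: the element `q` acts as `h * q * h⁻¹` did. -/
def conj {Q : Subgroup G} (h : normalizer Q) (σ : Representation K Q U) : Representation K Q U :=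
  σ.comp (Q.normalizerMonoidHom h).toMonoidHom

/-- `τ` is the Green correspondent in `H = N_G(Q)` of the indecomposable module `V` with vertex
`Q`: it is an indecomposable component of the restriction of `V` to `H` which has vertex `Q`. -/
def IsGreenCorrespondent (Q : Subgroup G) (τ : Representation K (normalizer Q) U)
    (ρ : Representation K G V) : Prop :=
  IsVertex Q ρ ∧ IsVertex (Q.subgroupOf (normalizer Q)) τ ∧ IsSummand τ (res (normalizer Q) ρ)

end Basic

/-- Simple `KG`-modules. -/
abbrev SimpleMod (K : Type u) [Field K] (G : Type v) [Group G] :=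
  {X : Rep.{w} K G // X.ρ.IsIrreducible}

/-- Isomorphism of simple `KG`-modules. -/
instance simpleSetoid (K : Type u) [Field K] (G : Type v) [Group G] :
    Setoid (SimpleMod.{u, v, w} K G) where
  r X Y := Nonempty (X.1.ρ.Equiv Y.1.ρ)
  iseqv :=
    { refl := fun X => ⟨Representation.Equiv.refl X.1.ρ⟩
      symm := fun ⟨e⟩ => ⟨e.symm⟩
      trans := fun ⟨e⟩ ⟨f⟩ => ⟨e.trans f⟩ }

/-- `ITS(KG)`: the set of isomorphism types of simple `KG`-modules. -/
abbrev ITS (K : Type u) [Field K] (G : Type v) [Group G] :=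
  Quotient (simpleSetoid.{u, v, w} K G)

/-- For a module `W` over the prime field `F = ZMod p`, the set `𝓔(W)` of all pairs `(K, V)` where
`K` is a finite subfield of `Fbar` and `V` is an indecomposable `KG`-module which is a component
of `K ⊗ W`. -/
def E {p : ℕ} [Fact p.Prime] (Fbar : Type u) [Field Fbar] [Algebra (ZMod p) Fbar]
    {G : Type v} [Group G] (W : Rep.{u} (ZMod p) G) :
    Set (Σ K : IntermediateField (ZMod p) Fbar, Rep.{u} K G) :=
  {KV | Finite KV.1 ∧ IsIndecomposable KV.2.ρ ∧ IsSummand KV.2.ρ (baseChange KV.1 W.ρ)}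

end GreenTheory

/-! Two notions that survive a change of field carry the proof. Relative projectivity is used in
Higman's form `IsTraceProjective`: the identity is the trace from `P` of a `P`-endomorphism
(`isRelProjective_iff`). Likewise, by `isSummand_ind_iff`, being a summand of a module induced from
`σ` means that the identity is the trace of a `Q`-map factoring through `σ`. The other notion,
`Occurs`, is the existence of a nonzero map from `L ⊗ W` to an `L`-module.

Over a subfield `F`, a simple `LG`-module in which a simple `FG`-module `W` occurs is a sum of
copies of `W`: scalars of `L` are `FG`-endomorphisms, so the `W`-isotypic part is an `LG`-submodule.
Hence the `W` occurring in `X` is unique (`Occurs.unique`), and this defines `Σ`. Matrix entries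
realize `X` over a finite field `K` by a module `V`, simple because `X` is. As `K` is separable over
`F`, `V` is a summand of `K ⊗ V|_F`, a sum of copies of `K ⊗ W`, hence of `K ⊗ W` itself, being
indecomposable (`Occurs.isSummand`). Every `W` occurs in a simple quotient of `Fbar ⊗ W`, so no
fiber is empty.

`V` is a summand of `K ⊗ W` and `W` is a summand of `V|_F`; Higman's criterion passes along both,
and also between `V` and `X`. So `W`, `V` and `X` are projective relative to the same subgroups and
have the same vertices.

For sources and Green correspondents, write `V` as a summand of a module induced from its source or
correspondent, extend scalars, and compare with those of `X`. The comparison is Mackey's formula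
`exists_bijective_relTr_conjComap` together with local endomorphism rings: minimality of the vertex
forces the relevant double coset into the normalizer (`IsVertexSource.exists_isSummand_conj`,
`IsGreenCorrespondent.isSummand`). -/

namespace GreenTheory

open Representation

/-! ### Equivariant maps and direct summands. -/

section Maps

variable {K G V U T : Type*} [Field K] [Group G]
  [AddCommGroup V] [Module K V] [AddCommGroup U] [Module K U] [AddCommGroup T] [Module K T]
  {ρ : Representation K G V} {σ : Representation K G U} {τ : Representation K G T}

lemma _root_.Representation.IsIntertwiningMap.comp_eq {f : V →ₗ[K] U}
    (hf : IsIntertwiningMap ρ σ f) (g : G) :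
    f ∘ₗ ρ g = σ g ∘ₗ f :=
  LinearMap.ext (hf.isIntertwining g)

lemma isIntertwiningMap_id : IsIntertwiningMap ρ ρ LinearMap.id := ⟨fun _ _ => rfl⟩

lemma _root_.Representation.IsIntertwiningMap.comp {f : U →ₗ[K] T} {g : V →ₗ[K] U}
    (hf : IsIntertwiningMap σ τ f)
    (hg : IsIntertwiningMap ρ σ g) : IsIntertwiningMap ρ τ (f ∘ₗ g) :=
  ⟨fun x v => by simp [hf.isIntertwining, hg.isIntertwining]⟩

lemma _root_.Representation.IsIntertwiningMap.add {f g : V →ₗ[K] U}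
    (hf : IsIntertwiningMap ρ σ f)
    (hg : IsIntertwiningMap ρ σ g) : IsIntertwiningMap ρ σ (f + g) :=
  ⟨fun x v => by simp [hf.isIntertwining, hg.isIntertwining]⟩

lemma _root_.Representation.IsIntertwiningMap.sum {ι : Type*} {s : Finset ι} {f : ι → V →ₗ[K] U}
    (hf : ∀ i ∈ s, IsIntertwiningMap ρ σ (f i)) : IsIntertwiningMap ρ σ (∑ i ∈ s, f i) :=
  ⟨fun x v => by
    simp only [LinearMap.sum_apply, map_sum]
    exact Finset.sum_congr rfl fun i hi => (hf i hi).isIntertwining x v⟩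

lemma _root_.Representation.IsIntertwiningMap.pow {f : V →ₗ[K] V}
    (hf : IsIntertwiningMap ρ ρ f) (n : ℕ) :
    IsIntertwiningMap ρ ρ (f ^ n) := by
  induction n with
  | zero => exact isIntertwiningMap_id
  | succ n ih => rw [pow_succ]; exact ih.comp hf

lemma _root_.Representation.IsIntertwiningMap.symm {e : V ≃ₗ[K] U}
    (he : IsIntertwiningMap ρ σ (e : V →ₗ[K] U)) :
    IsIntertwiningMap σ ρ (e.symm : U →ₗ[K] V) :=
  ⟨fun x v => by
    apply e.injective
    have := he.isIntertwining x (e.symm v)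
    simp only [LinearEquiv.coe_coe, LinearEquiv.apply_symm_apply] at this
    simp [this]⟩

/-- A bijective equivariant endomorphism has an equivariant inverse. -/
lemma _root_.Representation.IsIntertwiningMap.exists_inverse {f : V →ₗ[K] U}
    (hf : IsIntertwiningMap ρ σ f)
    (hb : Function.Bijective f) :
    ∃ g : U →ₗ[K] V, IsIntertwiningMap σ ρ g ∧ g ∘ₗ f = LinearMap.id ∧ f ∘ₗ g = LinearMap.id := by
  refine ⟨((LinearEquiv.ofBijective f hb).symm : U →ₗ[K] V), ?_, ?_, ?_⟩
  · exact IsIntertwiningMap.symm (e := LinearEquiv.ofBijective f hb) hf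
  · ext v; simp
  · ext v; exact (LinearEquiv.ofBijective f hb).apply_symm_apply v

lemma _root_.Representation.IsIntertwiningMap.res {f : V →ₗ[K] U}
    (hf : IsIntertwiningMap ρ σ f) (Q : Subgroup G) :
    IsIntertwiningMap (res Q ρ) (res Q σ) f :=
  ⟨fun x v => hf.isIntertwining x v⟩

lemma _root_.Representation.IsIntertwiningMap.toEquiv {f : V →ₗ[K] U}
    (hf : IsIntertwiningMap ρ σ f)
    (hb : Function.Bijective f) : Nonempty (ρ.Equiv σ) :=
  ⟨Representation.Equiv.mk (LinearEquiv.ofBijective f hb) fun g => by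
    ext v; exact hf.isIntertwining g v⟩

lemma isIntertwiningMap_of_intertwiningMap (f : IntertwiningMap ρ σ) :
    IsIntertwiningMap ρ σ f.toLinearMap :=
  ⟨f.isIntertwining⟩

/-- `σ` is a retract of `ρ` through the maps `i` and `p`. -/
structure IsRetract (σ : Representation K G U) (ρ : Representation K G V)
    (i : U →ₗ[K] V) (p : V →ₗ[K] U) : Prop where
  incl : IsIntertwiningMap σ ρ i
  proj : IsIntertwiningMap ρ σ p
  proj_incl : p ∘ₗ i = LinearMap.id

lemma IsRetract.trans {i : U →ₗ[K] V} {p : V →ₗ[K] U} {j : T →ₗ[K] U} {q : U →ₗ[K] T}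
    (h : IsRetract σ ρ i p) (h' : IsRetract τ σ j q) : IsRetract τ ρ (i ∘ₗ j) (q ∘ₗ p) :=
  ⟨h.incl.comp h'.incl, h'.proj.comp h.proj, by
    rw [LinearMap.comp_assoc, ← LinearMap.comp_assoc j, h.proj_incl, LinearMap.id_comp,
      h'.proj_incl]⟩

/-- An automorphism of `U` that factors through `V` splits `U` off `V`. Each bijective term found in
a sum is turned into a summand in this way. -/
lemma isRetract_of_bijective {f : U →ₗ[K] V} {g : V →ₗ[K] U} (hf : IsIntertwiningMap σ ρ f)
    (hg : IsIntertwiningMap ρ σ g) (hb : Function.Bijective (g ∘ₗ f)) :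
    ∃ p, IsRetract σ ρ f p := by
  obtain ⟨k, hk, h1, -⟩ := (hg.comp hf).exists_inverse hb
  exact ⟨k ∘ₗ g, hf, hk.comp hg, h1⟩

lemma IsRetract.proj_apply {i : U →ₗ[K] V} {p : V →ₗ[K] U} (h : IsRetract σ ρ i p) (x : U) :
    p (i x) = x :=
  LinearMap.congr_fun h.proj_incl x

lemma IsRetract.injective {i : U →ₗ[K] V} {p : V →ₗ[K] U} (h : IsRetract σ ρ i p) :
    Function.Injective i :=
  Function.LeftInverse.injective (g := p) h.proj_apply

lemma isRetract_of_equiv (e : σ.Equiv ρ) :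
    IsRetract σ ρ e.toLinearMap e.symm.toLinearMap :=
  ⟨isIntertwiningMap_of_intertwiningMap e.toIntertwiningMap,
    isIntertwiningMap_of_intertwiningMap e.symm.toIntertwiningMap,
    LinearMap.ext fun v => e.symm_apply_apply v⟩

lemma subrepresentation_isCompl_iff {A B : Subrepresentation ρ} :
    IsCompl A B ↔ IsCompl A.toSubmodule B.toSubmodule := by
  rw [isCompl_iff, isCompl_iff, disjoint_iff, disjoint_iff, codisjoint_iff, codisjoint_iff]
  constructor
  · rintro ⟨h1, h2⟩
    exact ⟨congrArg Subrepresentation.toSubmodule h1, congrArg Subrepresentation.toSubmodule h2⟩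
  · rintro ⟨h1, h2⟩
    exact ⟨Subrepresentation.toSubmodule_injective h1, Subrepresentation.toSubmodule_injective h2⟩

/-- Complementary subrepresentations are retracts by complementary idempotents. -/
lemma exists_isRetract_of_isCompl {A B : Subrepresentation ρ} (h : IsCompl A B) :
    ∃ pA pB, IsRetract A.toRepresentation ρ A.toSubmodule.subtype pA ∧
      IsRetract B.toRepresentation ρ B.toSubmodule.subtype pB ∧
      A.toSubmodule.subtype ∘ₗ pA + B.toSubmodule.subtype ∘ₗ pB = LinearMap.id := by
  have h' := subrepresentation_isCompl_iff.1 h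
  have key : ∀ (A B : Subrepresentation ρ) (h' : IsCompl A.toSubmodule B.toSubmodule),
      IsRetract A.toRepresentation ρ A.toSubmodule.subtype
        (A.toSubmodule.projectionOnto B.toSubmodule h') := by
    intro A B h'
    refine ⟨⟨fun g v => rfl⟩, ⟨fun g v => ?_⟩, ?_⟩
    · obtain ⟨a, ha, b, hb, rfl⟩ :=
        Submodule.mem_sup.1 (h'.codisjoint.eq_top.symm ▸ Submodule.mem_top : v ∈ _ ⊔ _)
      have e1 := Submodule.projectionOnto_apply_left h' ⟨a, ha⟩
      have e2 := (Submodule.projectionOnto_apply_eq_zero_iff h').2 hb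
      have e3 := Submodule.projectionOnto_apply_left h' ⟨ρ g a, A.apply_mem_toSubmodule g ha⟩
      have e4 := (Submodule.projectionOnto_apply_eq_zero_iff h').2 (B.apply_mem_toSubmodule g hb)
      simp only at e1 e3
      simp only [map_add, e1, e2, e3, e4, add_zero]
      rfl
    · ext x
      simp
  refine ⟨_, _, key A B h', key B A h'.symm, ?_⟩
  ext v
  simpa using Submodule.projection_add_projection_eq_self h' v

/-- The complement of `range i` is `ker p`. This form is used throughout, as functors such as
extension of scalars visibly preserve it. -/
lemma isSummand_iff : IsSummand σ ρ ↔ ∃ i p, IsRetract σ ρ i p := by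
  constructor
  · rintro ⟨A, B, h, ⟨e⟩⟩
    obtain ⟨pA, -, hA, -⟩ := exists_isRetract_of_isCompl h
    exact ⟨_, _, hA.trans (isRetract_of_equiv e)⟩
  · rintro ⟨i, p, h⟩
    refine ⟨⟨LinearMap.range i, ?_⟩, ⟨LinearMap.ker p, ?_⟩, ?_, ⟨Representation.Equiv.mk
      (LinearEquiv.ofInjective i h.injective) ?_⟩⟩
    · rintro g _ ⟨v, rfl⟩
      exact ⟨σ g v, h.incl.isIntertwining g v⟩
    · intro g v hv
      rw [LinearMap.mem_ker] at hv ⊢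
      rw [h.proj.isIntertwining, hv, map_zero]
    · rw [subrepresentation_isCompl_iff]
      refine IsCompl.of_eq ?_ ?_
      · rw [eq_bot_iff]
        rintro _ ⟨⟨v, rfl⟩, hv⟩
        have : p (i v) = 0 := hv
        rw [h.proj_apply] at this
        simp [this]
      · rw [eq_top_iff]
        intro v _
        refine Submodule.mem_sup.2 ⟨i (p v), ⟨_, rfl⟩, v - i (p v), ?_, by simp⟩
        simp [h.proj_apply]
    · intro g
      ext v
      exact h.incl.isIntertwining g v

lemma IsSummand.trans (h : IsSummand σ ρ) (h' : IsSummand τ σ) : IsSummand τ ρ := by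
  rw [isSummand_iff] at *
  obtain ⟨i, p, h⟩ := h
  obtain ⟨j, q, h'⟩ := h'
  exact ⟨_, _, h.trans h'⟩

lemma isSummand_of_equiv (e : σ.Equiv ρ) : IsSummand σ ρ :=
  isSummand_iff.2 ⟨_, _, isRetract_of_equiv e⟩

end Maps

/-! ### Fitting's lemma and local endomorphism rings. -/

section Local

variable {K G V U : Type*} [Field K] [Group G] [AddCommGroup V] [Module K V]
  [AddCommGroup U] [Module K U] {ρ : Representation K G V} {σ : Representation K G U}

/-- Fitting's lemma. -/
lemma IsIndecomposable.bijective_or_isNilpotent (h : IsIndecomposable ρ) {f : V →ₗ[K] V}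
    (hf : IsIntertwiningMap ρ ρ f) : Function.Bijective f ∨ IsNilpotent f := by
  obtain ⟨hfd, -, h⟩ := h
  obtain ⟨n, hn⟩ := (LinearMap.eventually_isCompl_ker_pow_range_pow f).exists_forall_of_atTop
  -- The exponent is made positive so that `ker f` lies in the kernel of the power.
  have hn := hn (n + 1) (by omega)
  have hfn := hf.pow (n + 1)
  let A : Subrepresentation ρ := ⟨LinearMap.ker (f ^ (n + 1)), fun g v hv => by
    rw [LinearMap.mem_ker] at hv ⊢
    rw [hfn.isIntertwining, hv, map_zero]⟩
  let B : Subrepresentation ρ := ⟨LinearMap.range (f ^ (n + 1)), fun g v hv => by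
    obtain ⟨w, rfl⟩ := hv
    exact ⟨ρ g w, hfn.isIntertwining g w⟩⟩
  rcases h A B (subrepresentation_isCompl_iff.2 hn) with hA | hB
  · left
    have hA' : LinearMap.ker (f ^ (n + 1)) = ⊥ := congrArg Subrepresentation.toSubmodule hA
    have hi : Function.Injective f := by
      rw [← LinearMap.ker_eq_bot, eq_bot_iff, ← hA']
      intro v hv
      rw [LinearMap.mem_ker] at hv ⊢
      rw [pow_succ, Module.End.mul_apply, hv, map_zero]
    exact ⟨hi, LinearMap.surjective_of_injective hi⟩
  · right
    have hB' : LinearMap.range (f ^ (n + 1)) = ⊥ := congrArg Subrepresentation.toSubmodule hB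
    exact ⟨n + 1, LinearMap.range_eq_bot.1 hB'⟩

/-- The endomorphism ring is local. With `k` the inverse of `f + g`, either `k ∘ f` is bijective or
it is nilpotent, and then `k ∘ g = 1 - k ∘ f` is a unit. -/
lemma IsIndecomposable.bijective_or_of_add (h : IsIndecomposable ρ) {f g : V →ₗ[K] V}
    (hf : IsIntertwiningMap ρ ρ f) (hg : IsIntertwiningMap ρ ρ g)
    (hb : Function.Bijective (f + g)) : Function.Bijective f ∨ Function.Bijective g := by
  obtain ⟨k, hk, h1, h2⟩ := (hf.add hg).exists_inverse hb
  have hkb : Function.Bijective k :=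
    ⟨Function.LeftInverse.injective (g := f + g) (LinearMap.congr_fun h2),
      Function.RightInverse.surjective (g := f + g) (LinearMap.congr_fun h1)⟩
  rcases h.bijective_or_isNilpotent (hk.comp hf) with h3 | h3
  · left
    rwa [LinearMap.coe_comp, Function.Bijective.of_comp_iff' hkb] at h3
  · right
    have h4 : IsUnit (k ∘ₗ g) := by
      have : k ∘ₗ g = 1 - k ∘ₗ f := by
        rw [eq_sub_iff_add_eq, add_comm, ← LinearMap.comp_add, h1]; rfl
      rw [this]
      exact h3.isUnit_one_sub
    rw [Module.End.isUnit_iff, LinearMap.coe_comp, Function.Bijective.of_comp_iff' hkb] at h4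
    exact h4

lemma IsIndecomposable.exists_bijective_of_sum (h : IsIndecomposable ρ) {ι : Type*}
    {s : Finset ι} {f : ι → V →ₗ[K] V} (hf : ∀ i ∈ s, IsIntertwiningMap ρ ρ (f i))
    (hb : Function.Bijective ⇑(∑ i ∈ s, f i : V →ₗ[K] V)) : ∃ i ∈ s, Function.Bijective (f i) := by
  classical
  induction s using Finset.induction_on with
  | empty =>
    obtain ⟨-, hn, -⟩ := h
    obtain ⟨x, y, hxy⟩ := hn
    exact absurd (hb.1 (by simp)) hxy
  | insert a s ha ih =>
    rw [Finset.sum_insert ha] at hb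
    rcases h.bijective_or_of_add (hf a (by simp))
      (IsIntertwiningMap.sum fun i hi => hf i (by simp [hi])) hb with h1 | h1
    · exact ⟨a, by simp, h1⟩
    · obtain ⟨i, hi, h2⟩ := ih (fun i hi => hf i (by simp [hi])) h1
      exact ⟨i, by simp [hi], h2⟩

/-- A nonzero retract of an indecomposable module is the whole module. -/
lemma IsIndecomposable.bijective_of_isRetract (h : IsIndecomposable ρ) [Nontrivial U]
    {i : U →ₗ[K] V} {p : V →ₗ[K] U} (hr : IsRetract σ ρ i p) : Function.Bijective i := by
  rcases h.bijective_or_isNilpotent (hr.incl.comp hr.proj) with h1 | ⟨n, h1⟩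
  · exact ⟨hr.injective, fun v => by obtain ⟨w, rfl⟩ := h1.2 v; exact ⟨p w, rfl⟩⟩
  · exfalso
    have : ∀ n : ℕ, ((i ∘ₗ p) ^ n) ∘ₗ i = i := by
      intro n
      induction n with
      | zero => rfl
      | succ n ih =>
        rw [pow_succ, Module.End.mul_eq_comp, LinearMap.comp_assoc, LinearMap.comp_assoc,
          hr.proj_incl, LinearMap.comp_id, ih]
    obtain ⟨x, hx⟩ := exists_ne (0 : U)
    apply hx
    apply hr.injective
    rw [← this n, h1, map_zero]
    rfl

/-- A decomposition of a module into indecomposables is detected by any additive functional with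
values in the (local) endomorphism ring of an indecomposable module. -/
lemma exists_indecomposable_isRetract {H : Type*} [Group H] {N : Type*} [AddCommGroup N]
    [Module K N] {π : Representation K H N} (hπ : IsIndecomposable π) [FiniteDimensional K V]
    (φ : (V →ₗ[K] V) →ₗ[K] (N →ₗ[K] N))
    (hφ : ∀ f, IsIntertwiningMap ρ ρ f → IsIntertwiningMap π π (φ f))
    (h1 : Function.Bijective (φ LinearMap.id)) :
    ∃ (A : Subrepresentation ρ) (p : V →ₗ[K] A.toSubmodule),
      IsIndecomposable A.toRepresentation ∧
      IsRetract A.toRepresentation ρ A.toSubmodule.subtype p ∧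
      Function.Bijective (φ (A.toSubmodule.subtype ∘ₗ p)) := by
  -- Take a summand of least dimension whose idempotent has bijective image under `φ`. If it splits,
  -- locality passes bijectivity to one piece, and minimality makes the other piece zero.
  let P : ℕ → Prop := fun n => ∃ (A : Subrepresentation ρ) (p : V →ₗ[K] A.toSubmodule),
      IsRetract A.toRepresentation ρ A.toSubmodule.subtype p ∧
      Function.Bijective (φ (A.toSubmodule.subtype ∘ₗ p)) ∧ Module.finrank K A.toSubmodule = n
  have hP : ∃ n, P n := by
    refine ⟨_, ⊤, LinearMap.codRestrict _ LinearMap.id fun _ => trivial, ⟨⟨fun _ _ => rfl⟩,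
      ⟨fun _ _ => rfl⟩, rfl⟩, ?_, rfl⟩
    exact h1
  classical
  obtain ⟨A, p, hA, hb, hn⟩ := Nat.find_spec hP
  refine ⟨A, p, ⟨inferInstance, ?_, ?_⟩, hA, hb⟩
  · by_contra hnt
    rw [not_nontrivial_iff_subsingleton] at hnt
    have : A.toSubmodule.subtype ∘ₗ p = 0 := by
      ext v
      simp [Subsingleton.elim (p v) 0]
    rw [this, map_zero] at hb
    obtain ⟨-, ⟨x, y, hxy⟩, -⟩ := hπ
    exact hxy (hb.1 rfl)
  · intro B C hBC
    obtain ⟨pB, pC, hB, hC, hsum⟩ := exists_isRetract_of_isCompl hBC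
    have key : ∀ (B C : Subrepresentation A.toRepresentation) (pB), IsCompl B C →
        IsRetract B.toRepresentation A.toRepresentation B.toSubmodule.subtype pB →
        Function.Bijective (φ ((A.toSubmodule.subtype ∘ₗ B.toSubmodule.subtype) ∘ₗ (pB ∘ₗ p))) →
        C = ⊥ := by
      intro B C pB hBC hB hb
      let D : Subrepresentation ρ := ⟨B.toSubmodule.map A.toSubmodule.subtype, by
        rintro g _ ⟨v, hv, rfl⟩
        exact ⟨_, B.apply_mem_toSubmodule g hv, rfl⟩⟩
      let e : B.toSubmodule ≃ₗ[K] D.toSubmodule :=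
        Submodule.equivMapOfInjective _ A.toSubmodule.injective_subtype B.toSubmodule
      have he : IsIntertwiningMap B.toRepresentation D.toRepresentation (e : _ →ₗ[K] _) :=
        ⟨fun g v => rfl⟩
      have hD : IsRetract D.toRepresentation ρ D.toSubmodule.subtype
          ((e : _ →ₗ[K] _) ∘ₗ (pB ∘ₗ p)) := by
        have h2 := (hA.trans hB).trans ⟨he.symm, he, LinearMap.ext e.apply_symm_apply⟩
        convert h2 using 1
        ext x
        obtain ⟨y, rfl⟩ := e.surjective x
        simp only [LinearMap.comp_apply, LinearEquiv.coe_coe, e.symm_apply_apply]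
        rfl
      have hDn : P (Module.finrank K D.toSubmodule) := by
        refine ⟨D, _, hD, ?_, rfl⟩
        exact hb
      have h3 := Nat.find_min' hP hDn
      rw [← hn, ← e.finrank_eq] at h3
      have h4 := Submodule.finrank_add_eq_of_isCompl (subrepresentation_isCompl_iff.1 hBC)
      have h5 : Module.finrank K C.toSubmodule = 0 := by omega
      exact Subrepresentation.toSubmodule_injective (Submodule.finrank_eq_zero.1 h5)
    have hsum' : (A.toSubmodule.subtype ∘ₗ B.toSubmodule.subtype) ∘ₗ (pB ∘ₗ p) +
        (A.toSubmodule.subtype ∘ₗ C.toSubmodule.subtype) ∘ₗ (pC ∘ₗ p) =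
        A.toSubmodule.subtype ∘ₗ p := by
      ext v
      have := congrArg (A.toSubmodule.subtype) (LinearMap.congr_fun hsum (p v))
      simpa using this
    rw [← hsum', map_add] at hb
    rcases hπ.bijective_or_of_add
      (hφ _ ((hA.incl.comp hB.incl).comp (hB.proj.comp hA.proj)))
      (hφ _ ((hA.incl.comp hC.incl).comp (hC.proj.comp hA.proj))) hb with h | h
    · exact Or.inr (key B C pB hBC hB h)
    · exact Or.inl (key C B pC hBC.symm hC h)

end Local

/-! ### The relative trace. -/

section Trace

variable {K G V U T : Type*} [Field K] [Group G]
  [AddCommGroup V] [Module K V] [AddCommGroup U] [Module K U] [AddCommGroup T] [Module K T]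
  (ρ : Representation K G V) (σ : Representation K G U) {τ : Representation K G T}

lemma linearMap_comp_sum {ι : Type*} (s : Finset ι) (h : U →ₗ[K] T) (f : ι → V →ₗ[K] U) :
    h ∘ₗ ∑ i ∈ s, f i = ∑ i ∈ s, h ∘ₗ f i :=
  LinearMap.ext fun v => by simp

lemma linearMap_sum_comp {ι : Type*} (s : Finset ι) (f : ι → V →ₗ[K] U) (h : T →ₗ[K] V) :
    (∑ i ∈ s, f i) ∘ₗ h = ∑ i ∈ s, f i ∘ₗ h :=
  LinearMap.ext fun v => by simp

/-- The relative trace map: the sum of the conjugates of a linear map over the cosets of `P`. -/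
noncomputable def relTr [Finite G] (P : Subgroup G) : (V →ₗ[K] U) →ₗ[K] (V →ₗ[K] U) :=
  letI := Fintype.ofFinite (G ⧸ P)
  ∑ x : G ⧸ P, linHom ρ σ x.out

lemma relTr_apply [Finite G] (P : Subgroup G) [Fintype (G ⧸ P)] (f : V →ₗ[K] U) :
    relTr ρ σ P f = ∑ x : G ⧸ P, linHom ρ σ x.out f := by
  rw [relTr, LinearMap.sum_apply]
  exact Finset.sum_congr (by ext; simp) fun _ _ => rfl

variable {ρ σ}

lemma linHom_eq_iff {f : V →ₗ[K] U} {g : G} : linHom ρ σ g f = f ↔ ∀ v, f (ρ g v) = σ g (f v) := by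
  constructor
  · intro h v
    have := LinearMap.congr_fun h (ρ g v)
    simpa [linHom_apply] using this.symm
  · intro h
    ext v
    simp [linHom_apply, ← h]

lemma isIntertwiningMap_iff_linHom {f : V →ₗ[K] U} :
    IsIntertwiningMap ρ σ f ↔ ∀ g, linHom ρ σ g f = f := by
  simp only [linHom_eq_iff]
  exact isIntertwiningMap_iff ..

lemma isIntertwiningMap_res_iff {P : Subgroup G} {f : V →ₗ[K] U} :
    IsIntertwiningMap (res P ρ) (res P σ) f ↔ ∀ g ∈ P, linHom ρ σ g f = f := by
  rw [isIntertwiningMap_iff_linHom]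
  exact ⟨fun h g hg => h ⟨g, hg⟩, fun h g => h g g.2⟩

lemma comp_linHom {h : U →ₗ[K] T} (hh : IsIntertwiningMap σ τ h) (g : G) (f : V →ₗ[K] U) :
    h ∘ₗ linHom ρ σ g f = linHom ρ τ g (h ∘ₗ f) := by
  ext v
  simp [linHom_apply, hh.isIntertwining]

lemma linHom_comp {h : T →ₗ[K] V} (hh : IsIntertwiningMap τ ρ h) (g : G) (f : V →ₗ[K] U) :
    linHom ρ σ g f ∘ₗ h = linHom τ σ g (f ∘ₗ h) := by
  ext v
  simp [linHom_apply, hh.isIntertwining]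

lemma linHom_comp_hom {Γ : Type*} [Group Γ] (φ : Γ →* G) (γ : Γ) (f : V →ₗ[K] U) :
    linHom (ρ.comp φ : Representation K Γ V) (σ.comp φ : Representation K Γ U) γ f =
      linHom ρ σ (φ γ) f := by
  ext v
  simp [linHom_apply]

/-- Conjugates of a `P`-equivariant map depend only on the coset, so `G` permutes the terms of its
trace. -/
lemma linHom_out_smul {P : Subgroup G} {f : V →ₗ[K] U}
    (hf : IsIntertwiningMap (res P ρ) (res P σ) f) (g : G) (x : G ⧸ P) :
    linHom ρ σ (g • x).out f = linHom ρ σ g (linHom ρ σ x.out f) := by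
  rw [isIntertwiningMap_res_iff] at hf
  have h1 : (QuotientGroup.mk (g * x.out) : G ⧸ P) = QuotientGroup.mk (g • x).out := by
    rw [QuotientGroup.out_eq', ← smul_eq_mul, ← MulAction.Quotient.smul_mk, QuotientGroup.out_eq']
  rw [QuotientGroup.eq] at h1
  have h2 := hf _ h1
  rw [← Module.End.mul_apply, ← map_mul]
  conv_rhs => rw [← h2]
  rw [← Module.End.mul_apply, ← map_mul, mul_inv_cancel_left]

variable [Finite G]

lemma relTr_intertwining {P : Subgroup G} {f : V →ₗ[K] U}
    (hf : IsIntertwiningMap (res P ρ) (res P σ) f) : IsIntertwiningMap ρ σ (relTr ρ σ P f) := by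
  let _ := Fintype.ofFinite (G ⧸ P)
  rw [isIntertwiningMap_iff_linHom]
  intro g
  rw [relTr_apply, map_sum]
  exact Fintype.sum_equiv (MulAction.toPerm g) _ _ fun x => (linHom_out_smul hf g x).symm

lemma comp_relTr {P : Subgroup G} {h : U →ₗ[K] T} (hh : IsIntertwiningMap σ τ h)
    (f : V →ₗ[K] U) : h ∘ₗ relTr ρ σ P f = relTr ρ τ P (h ∘ₗ f) := by
  let _ := Fintype.ofFinite (G ⧸ P)
  rw [relTr_apply, relTr_apply, linearMap_comp_sum]
  exact Finset.sum_congr rfl fun x _ => comp_linHom hh _ _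

lemma relTr_comp {P : Subgroup G} {h : T →ₗ[K] V} (hh : IsIntertwiningMap τ ρ h)
    (f : V →ₗ[K] U) : relTr ρ σ P f ∘ₗ h = relTr τ σ P (f ∘ₗ h) := by
  let _ := Fintype.ofFinite (G ⧸ P)
  rw [relTr_apply, relTr_apply, linearMap_sum_comp]
  exact Finset.sum_congr rfl fun x _ => linHom_comp hh _ _

lemma relTr_top {f : V →ₗ[K] U} (hf : IsIntertwiningMap ρ σ f) :
    relTr ρ σ ⊤ f = f := by
  let _ := Fintype.ofFinite (G ⧸ (⊤ : Subgroup G))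
  have : Subsingleton (G ⧸ (⊤ : Subgroup G)) := QuotientGroup.subsingleton_quotient_top
  let _ : Unique (G ⧸ (⊤ : Subgroup G)) :=
    { default := QuotientGroup.mk 1, uniq := fun x => Subsingleton.elim _ _ }
  rw [relTr_apply, Fintype.sum_unique]
  exact isIntertwiningMap_iff_linHom.1 hf _

/-- Products of coset representatives of `G / Q` and `Q / P` represent `G / P`. -/
lemma relTr_trans {P Q : Subgroup G} (hPQ : P ≤ Q) {f : V →ₗ[K] U}
    (hf : IsIntertwiningMap (res P ρ) (res P σ) f) :
    relTr ρ σ Q (relTr (res Q ρ) (res Q σ) (P.subgroupOf Q) f) = relTr ρ σ P f := by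
  let _ := Fintype.ofFinite (G ⧸ P)
  let _ := Fintype.ofFinite (G ⧸ Q)
  let _ := Fintype.ofFinite (Q ⧸ P.subgroupOf Q)
  simp only [relTr_apply, map_sum]
  rw [Finset.sum_comm, ← Fintype.sum_prod_type' (f := fun (y : G ⧸ Q) (z : Q ⧸ P.subgroupOf Q) =>
    linHom ρ σ y.out (linHom (res Q ρ) (res Q σ) z.out f))]
  refine Fintype.sum_equiv (Subgroup.quotientEquivProdOfLE hPQ).symm _ _ ?_
  rintro ⟨y, z⟩
  have h1 : (Subgroup.quotientEquivProdOfLE hPQ).symm (y, z) =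
      (y.out * (z.out : G)) • (QuotientGroup.mk 1 : G ⧸ P) := by
    conv_lhs => rw [← QuotientGroup.out_eq' z]
    rw [MulAction.Quotient.smul_mk, smul_eq_mul, mul_one]
    rfl
  rw [h1, linHom_out_smul hf, map_mul, Module.End.mul_apply]
  congr 1
  have h2 : linHom ρ σ (QuotientGroup.mk 1 : G ⧸ P).out f = f := by
    refine isIntertwiningMap_res_iff.1 hf _ ?_
    have := QuotientGroup.mk_out_eq_mul P (1 : G)
    obtain ⟨h, hh⟩ := this
    rw [hh, one_mul]
    exact h.2
  rw [h2]
  rfl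

end Trace

/-! ### Mackey's formula for traces. -/

section Mackey

lemma sum_eq_sum_orbits {Γ X M : Type*} [Group Γ] [MulAction Γ X] [Fintype X]
    [Fintype (MulAction.orbitRel.Quotient Γ X)]
    [∀ x : X, Fintype (Γ ⧸ MulAction.stabilizer Γ x)] [AddCommMonoid M] (F : X → M) :
    ∑ x, F x = ∑ ω : MulAction.orbitRel.Quotient Γ X,
      ∑ y : Γ ⧸ MulAction.stabilizer Γ ω.out, F (y.out • ω.out) := by
  rw [← Fintype.sum_sigma']
  refine Fintype.sum_equiv (MulAction.selfEquivSigmaOrbitsQuotientStabilizer Γ X) _ _ fun x => ?_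
  obtain ⟨⟨ω, y⟩, rfl⟩ := (MulAction.selfEquivSigmaOrbitsQuotientStabilizer Γ X).symm.surjective x
  rw [Equiv.apply_symm_apply]
  congr 1
  conv_lhs => rw [← QuotientGroup.out_eq' y]
  rfl

/-- The subgroup `φ⁻¹(g P g⁻¹)`. -/
def conjComap {Γ G : Type*} [Group Γ] [Group G] (φ : Γ →* G) (P : Subgroup G) (g : G) :
    Subgroup Γ :=
  P.comap ((MulAut.conj g⁻¹).toMonoidHom.comp φ)

lemma mem_conjComap {Γ G : Type*} [Group Γ] [Group G] {φ : Γ →* G} {P : Subgroup G} {g : G}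
    {γ : Γ} : γ ∈ conjComap φ P g ↔ g⁻¹ * φ γ * g ∈ P := by
  simp [conjComap]

variable {K Γ G V S : Type*} [Field K] [Group G] [Finite G] [Group Γ] [Finite Γ]
  [AddCommGroup V] [Module K V] [AddCommGroup S] [Module K S]
  {ρ : Representation K G V} {σ : Representation K Γ S}

/-- Mackey's formula for an indecomposable direct summand of a restriction. -/
lemma exists_bijective_relTr_conjComap (φ : Γ →* G) {P : Subgroup G} {β : V →ₗ[K] V}
    (hβ : IsIntertwiningMap (res P ρ) (res P ρ) β) (h1 : relTr ρ ρ P β = LinearMap.id)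
    (hσ : IsIndecomposable σ) {i : S →ₗ[K] V} {p : V →ₗ[K] S}
    (hr : IsRetract σ (ρ.comp φ) i p) :
    ∃ g : G, IsIntertwiningMap (res (conjComap φ P g) σ) (res (conjComap φ P g) σ)
        (p ∘ₗ linHom ρ ρ g β ∘ₗ i) ∧
      Function.Bijective (relTr σ σ (conjComap φ P g) (p ∘ₗ linHom ρ ρ g β ∘ₗ i)) := by
  classical
  -- Let `Γ` act on `G / P` through `φ`; its orbits are the double cosets `φ(Γ) \ G / P`.
  let _ : MulAction Γ (G ⧸ P) := MulAction.compHom (G ⧸ P) φ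
  let _ := Fintype.ofFinite (G ⧸ P)
  let _ := Fintype.ofFinite (MulAction.orbitRel.Quotient Γ (G ⧸ P))
  let _ : ∀ x : G ⧸ P, Fintype (Γ ⧸ MulAction.stabilizer Γ x) := fun x => Fintype.ofFinite _
  let F : G ⧸ P → (S →ₗ[K] S) := fun x => p ∘ₗ linHom ρ ρ x.out β ∘ₗ i
  have hF : ∀ (γ : Γ) (x : G ⧸ P), F (γ • x) = linHom σ σ γ (F x) := by
    intro γ x
    have h2 : linHom ρ ρ (φ γ • x).out β =
        linHom (ρ.comp φ : Representation K Γ V) (ρ.comp φ : Representation K Γ V) γ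
        (linHom ρ ρ x.out β) :=
      (linHom_out_smul hβ (φ γ) x).trans (linHom_comp_hom φ γ _).symm
    change p ∘ₗ linHom ρ ρ (φ γ • x).out β ∘ₗ i = _
    rw [h2, linHom_comp hr.incl, comp_linHom hr.proj]
  have hFi : ∀ x, IsIntertwiningMap (res (MulAction.stabilizer Γ x) σ)
      (res (MulAction.stabilizer Γ x) σ) (F x) := by
    intro x
    rw [isIntertwiningMap_res_iff]
    intro γ hγ
    rw [← hF, MulAction.mem_stabilizer_iff.1 hγ]
  -- Compressed to `S`, the trace of `β` is the identity, and it splits into one trace per orbit. By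
  -- locality some orbit contributes a bijection.
  have hsum : ∑ ω : MulAction.orbitRel.Quotient Γ (G ⧸ P),
      relTr σ σ (MulAction.stabilizer Γ ω.out) (F ω.out) = LinearMap.id := by
    simp only [relTr_apply, ← hF]
    rw [← sum_eq_sum_orbits F, ← hr.proj_incl]
    conv_rhs => rw [← LinearMap.id_comp i, ← h1, relTr_apply, linearMap_sum_comp,
      linearMap_comp_sum]
  obtain ⟨ω, -, hω⟩ := hσ.exists_bijective_of_sum
    (fun ω _ => relTr_intertwining (hFi (Quotient.out ω)))
    (by rw [hsum]; exact Function.bijective_id)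
  have hstab : MulAction.stabilizer Γ ω.out = conjComap φ P (ω.out : G ⧸ P).out := by
    ext γ
    rw [mem_conjComap, MulAction.mem_stabilizer_iff]
    change φ γ • (ω.out : G ⧸ P) = _ ↔ _
    conv_lhs => rw [← QuotientGroup.out_eq' (ω.out : G ⧸ P)]
    rw [MulAction.Quotient.smul_mk, eq_comm, QuotientGroup.eq, smul_eq_mul, mul_assoc]
  refine ⟨(ω.out : G ⧸ P).out, ?_, ?_⟩
  · rw [← hstab]; exact hFi _
  · rw [← hstab]; exact hω

end Mackey

/-! ### Higman's criterion. -/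

section RelProj

variable {K G V U T : Type*} [Field K] [Group G] [Finite G]
  [AddCommGroup V] [Module K V] [AddCommGroup U] [Module K U]

/-- Higman's criterion: the identity is a relative trace. -/
def IsTraceProjective (P : Subgroup G) (ρ : Representation K G V) : Prop :=
  ∃ β : V →ₗ[K] V, IsIntertwiningMap (res P ρ) (res P ρ) β ∧ relTr ρ ρ P β = LinearMap.id

variable {ρ : Representation K G V} {σ : Representation K G U}

/-- Composing with the inverse of the trace, which is `G`-equivariant and moves inside it,
normalizes the trace to the identity. -/
lemma isTraceProjective_of_bijective {P : Subgroup G} {β : V →ₗ[K] V}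
    (hβ : IsIntertwiningMap (res P ρ) (res P ρ) β) (h : Function.Bijective (relTr ρ ρ P β)) :
    IsTraceProjective P ρ := by
  obtain ⟨k, hk, h1, -⟩ := (relTr_intertwining hβ).exists_inverse h
  exact ⟨k ∘ₗ β, (hk.res P).comp hβ, by rw [← comp_relTr hk, h1]⟩

lemma IsTraceProjective.of_isRetract {P : Subgroup G} (h : IsTraceProjective P ρ)
    {i : U →ₗ[K] V} {p : V →ₗ[K] U} (hr : IsRetract σ ρ i p) : IsTraceProjective P σ := by
  obtain ⟨β, hβ, h1⟩ := h
  refine ⟨p ∘ₗ β ∘ₗ i, (hr.proj.res P).comp (hβ.comp (hr.incl.res P)), ?_⟩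
  rw [← comp_relTr hr.proj, ← relTr_comp hr.incl, h1, LinearMap.id_comp, hr.proj_incl]

lemma IsTraceProjective.exists_conjComap {Γ S : Type*} [Group Γ] [Finite Γ] [AddCommGroup S]
    [Module K S] {τ : Representation K Γ S} {P : Subgroup G} (h : IsTraceProjective P ρ)
    (φ : Γ →* G) (hτ : IsIndecomposable τ) {i : S →ₗ[K] V} {p : V →ₗ[K] S}
    (hr : IsRetract τ (ρ.comp φ) i p) : ∃ g : G, IsTraceProjective (conjComap φ P g) τ := by
  obtain ⟨β, hβ, h1⟩ := h
  obtain ⟨g, h2, h3⟩ := exists_bijective_relTr_conjComap φ hβ h1 hτ hr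
  exact ⟨g, isTraceProjective_of_bijective h2 h3⟩

end RelProj

/-! ### Induced modules through traces. -/

section Ind

variable {K G V S : Type*} [Field K] [Group G] [AddCommGroup V] [Module K V]
  [AddCommGroup S] [Module K S] {Q : Subgroup G} (σ : Representation K Q S)

open Classical in
/-- The projection of an induced module onto the summand indexed by the trivial coset. -/
noncomputable def indProj : IndV Q.subtype σ →ₗ[K] S :=
  Coinvariants.lift _ (TensorProduct.lift ((Finsupp.lift (S →ₗ[K] S) K G fun h =>
    if hh : h ∈ Q then σ ⟨h, hh⟩⁻¹ else 0) ∘ₗ (MonoidAlgebra.coeffLinearEquiv K).toLinearMap))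
    (by
      intro q
      ext h x
      have hq : (q : G) * h ∈ Q ↔ h ∈ Q := Subgroup.mul_mem_cancel_left Q q.2
      by_cases hh : h ∈ Q
      · have : (⟨q * h, hq.2 hh⟩ : Q) = q * ⟨h, hh⟩ := rfl
        simp [hh, hq.2 hh, this, ← Module.End.mul_apply, ← map_mul]
      · simp [hh, hq])

open Classical in
lemma indProj_mk (h : G) (s : S) :
    indProj σ (IndV.mk Q.subtype σ h s) = if hh : h ∈ Q then σ ⟨h, hh⟩⁻¹ s else 0 := by
  simp only [indProj, LinearMap.comp_apply, TensorProduct.mk_apply, Coinvariants.lift_mk]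
  split_ifs with hh <;> simp [hh]

lemma indProj_mk_of_mem {h : G} (hh : h ∈ Q) (s : S) :
    indProj σ (IndV.mk Q.subtype σ h s) = σ ⟨h, hh⟩⁻¹ s := by
  rw [indProj_mk, dif_pos hh]

lemma indProj_mk_of_notMem {h : G} (hh : h ∉ Q) (s : S) :
    indProj σ (IndV.mk Q.subtype σ h s) = 0 := by
  rw [indProj_mk, dif_neg hh]

/-- In this model `IndV.mk h s` plays the part of `h⁻¹ ⊗ s`, which accounts for the inverses in what
follows. -/
lemma indV_mk_mul (q : Q) (h : G) (s : S) :
    IndV.mk Q.subtype σ (q * h) (σ q s) = IndV.mk Q.subtype σ h s := by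
  have := Coinvariants.mk_self_apply
    (Representation.tprod ((leftRegular K G).comp Q.subtype) σ) q
    ((MonoidAlgebra.single h 1) ⊗ₜ[K] s)
  simpa using this

lemma indMk_intertwining : IsIntertwiningMap σ (res Q (ind Q σ)) (IndV.mk Q.subtype σ 1) :=
  ⟨fun q s => by
    have h := indV_mk_mul σ q (q⁻¹ : Q) s
    have h2 := ind_mk Q.subtype σ (q : G) 1 s
    rw [InvMemClass.coe_inv, mul_inv_cancel] at h
    rw [one_mul] at h2
    exact h.trans h2.symm⟩

lemma indProj_intertwining : IsIntertwiningMap (res Q (ind Q σ)) σ (indProj σ) :=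
  ⟨fun q x => by
    suffices h : indProj σ ∘ₗ ind Q σ (q : G) = σ q ∘ₗ indProj σ from LinearMap.congr_fun h x
    refine IndV.hom_ext _ _ fun h => LinearMap.ext fun s => ?_
    change indProj σ (Representation.ind Q.subtype σ q (IndV.mk Q.subtype σ h s)) =
      σ q (indProj σ (IndV.mk Q.subtype σ h s))
    rw [ind_mk]
    by_cases hh : h ∈ Q
    · rw [indProj_mk_of_mem σ hh, indProj_mk_of_mem σ (Q.mul_mem hh (Q.inv_mem q.2)),
        ← Module.End.mul_apply, ← map_mul]
      congr 2
      ext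
      simp
    · rw [indProj_mk_of_notMem σ hh, indProj_mk_of_notMem, map_zero]
      rwa [Subgroup.mul_mem_cancel_right Q (Q.inv_mem q.2)]⟩

lemma indProj_comp_indMk : indProj σ ∘ₗ IndV.mk Q.subtype σ 1 = LinearMap.id := by
  ext s
  change indProj σ (IndV.mk Q.subtype σ 1 s) = s
  rw [indProj_mk_of_mem σ Q.one_mem]
  have : (⟨1, Q.one_mem⟩ : Q)⁻¹ = 1 := by ext; simp
  rw [this, map_one, Module.End.one_apply]

variable [Finite G]

/-- The induced module is the direct sum of its translates of `S`, and the conjugates of the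
projection onto the trivial one are the projections onto them. -/
lemma relTr_ind_eq_id :
    relTr (ind Q σ) (ind Q σ) Q (IndV.mk Q.subtype σ 1 ∘ₗ indProj σ) = LinearMap.id := by
  let _ := Fintype.ofFinite (G ⧸ Q)
  refine IndV.hom_ext _ _ fun h => LinearMap.ext fun s => ?_
  rw [relTr_apply, LinearMap.comp_apply, LinearMap.sum_apply, Finset.sum_eq_single
    (QuotientGroup.mk h⁻¹)]
  · set y := (QuotientGroup.mk h⁻¹ : G ⧸ Q).out with hy
    have hq : h * y ∈ Q := by
      have : (QuotientGroup.mk h⁻¹ : G ⧸ Q) = QuotientGroup.mk y := (QuotientGroup.out_eq' _).symm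
      simpa using QuotientGroup.eq.1 this
    rw [linHom_apply]
    change Representation.ind Q.subtype σ y (IndV.mk Q.subtype σ 1 (indProj σ
      (Representation.ind Q.subtype σ y⁻¹ (IndV.mk Q.subtype σ h s)))) = IndV.mk Q.subtype σ h s
    erw [ind_mk Q.subtype σ y⁻¹ h s]
    rw [inv_inv, indProj_mk_of_mem σ hq, ind_mk, one_mul,
      ← indV_mk_mul σ (⟨h * y, hq⟩⁻¹ : Q) h s]
    congr 2
    simp
  · intro x _ hx
    rw [linHom_apply]
    change Representation.ind Q.subtype σ x.out (IndV.mk Q.subtype σ 1 (indProj σ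
      (Representation.ind Q.subtype σ x.out⁻¹ (IndV.mk Q.subtype σ h s)))) = 0
    erw [ind_mk Q.subtype σ x.out⁻¹ h s]
    rw [inv_inv, indProj_mk_of_notMem, map_zero, map_zero]
    intro hq
    apply hx
    rw [← QuotientGroup.out_eq' x, eq_comm, QuotientGroup.eq, inv_inv]
    exact hq
  · simp

variable {σ} {ρ : Representation K G V}

/-- Frobenius reciprocity: the trace is the `G`-map corresponding to `a`, since the projection kills
all terms but that of the trivial coset. -/
lemma indProj_comp_relTr {a : V →ₗ[K] S} (ha : IsIntertwiningMap (res Q ρ) σ a) :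
    indProj σ ∘ₗ relTr ρ (ind Q σ) Q (IndV.mk Q.subtype σ 1 ∘ₗ a) = a := by
  let _ := Fintype.ofFinite (G ⧸ Q)
  rw [relTr_apply, linearMap_comp_sum, Finset.sum_eq_single (QuotientGroup.mk 1)]
  · have h1 : (QuotientGroup.mk 1 : G ⧸ Q).out ∈ Q := by
      obtain ⟨h, hh⟩ := QuotientGroup.mk_out_eq_mul Q (1 : G)
      rw [hh, one_mul]
      exact h.2
    have h2 := (isIntertwiningMap_res_iff (ρ := ρ) (σ := ind Q σ)).1
      ((indMk_intertwining σ).comp ha) _ h1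
    rw [h2, ← LinearMap.comp_assoc, indProj_comp_indMk, LinearMap.id_comp]
  · intro x _ hx
    ext v
    rw [linHom_apply]
    change indProj σ (Representation.ind Q.subtype σ x.out (IndV.mk Q.subtype σ 1
      (a (ρ x.out⁻¹ v)))) = 0
    rw [ind_mk, one_mul, indProj_mk_of_notMem]
    intro hq
    apply hx
    rw [← QuotientGroup.out_eq' x, eq_comm, QuotientGroup.eq, inv_one, one_mul]
    exact inv_mem_iff.1 hq
  · simp

/-- Transitivity of induction in terms of relative traces. -/
lemma relTr_comp_relTr_ind {a : V →ₗ[K] S}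
    (ha : IsIntertwiningMap (res Q ρ) σ a) (b : S →ₗ[K] V) :
    relTr (ind Q σ) ρ Q (b ∘ₗ indProj σ) ∘ₗ relTr ρ (ind Q σ) Q (IndV.mk Q.subtype σ 1 ∘ₗ a) =
      relTr ρ ρ Q (b ∘ₗ a) := by
  rw [relTr_comp (relTr_intertwining ((indMk_intertwining σ).comp ha)), LinearMap.comp_assoc,
    indProj_comp_relTr ha]

/-- Frobenius reciprocity on both sides turns the inclusion and projection of a summand into
`Q`-maps `a` and `b`. The resulting condition no longer mentions the induced module and can be
extended to larger fields termwise. -/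
lemma isSummand_ind_iff : IsSummand ρ (ind Q σ) ↔ ∃ (a : V →ₗ[K] S) (b : S →ₗ[K] V),
    IsIntertwiningMap (res Q ρ) σ a ∧ IsIntertwiningMap σ (res Q ρ) b ∧
      relTr ρ ρ Q (b ∘ₗ a) = LinearMap.id := by
  rw [isSummand_iff]
  constructor
  · rintro ⟨i, p, h⟩
    refine ⟨indProj σ ∘ₗ i, p ∘ₗ IndV.mk Q.subtype σ 1,
      (indProj_intertwining σ).comp (h.incl.res Q), (h.proj.res Q).comp (indMk_intertwining σ), ?_⟩
    rw [LinearMap.comp_assoc, ← comp_relTr h.proj, ← LinearMap.comp_assoc, ← relTr_comp h.incl,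
      relTr_ind_eq_id, LinearMap.id_comp, h.proj_incl]
  · rintro ⟨a, b, ha, hb, h⟩
    exact ⟨_, _, relTr_intertwining ((indMk_intertwining σ).comp ha),
      relTr_intertwining (hb.comp (indProj_intertwining σ)), by rw [relTr_comp_relTr_ind ha b, h]⟩

lemma isRelProjective_iff : IsRelProjective Q ρ ↔ IsTraceProjective Q ρ := by
  rw [IsRelProjective, isSummand_ind_iff]
  constructor
  · rintro ⟨a, b, ha, hb, h⟩
    exact ⟨_, hb.comp ha, h⟩
  · rintro ⟨β, hβ, h⟩
    exact ⟨β, LinearMap.id, hβ, isIntertwiningMap_id, h⟩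

lemma isTraceProjective_ind : IsTraceProjective Q (ind Q σ) :=
  ⟨_, (indMk_intertwining σ).comp (indProj_intertwining σ), relTr_ind_eq_id σ⟩

lemma isVertex_iff : IsVertex Q ρ ↔
    IsIndecomposable ρ ∧ Minimal (fun P : Subgroup G => IsTraceProjective P ρ) Q := by
  simp only [IsVertex, isRelProjective_iff]

end Ind

/-! ### Conjugation by the normalizer. -/

section Conj

variable {K G S T : Type*} [Field K] [Group G] {Q : Subgroup G}
  [AddCommGroup S] [Module K S] [AddCommGroup T] [Module K T]

/-- For a finite group, one inclusion between `Q` and its conjugate is already an equality. -/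
lemma mem_normalizer_of_conj_inv_mem [Finite G] {g : G} (h : ∀ q ∈ Q, g⁻¹ * q * g ∈ Q) :
    g ∈ normalizer Q := by
  rw [← inv_mem_iff]
  exact Subgroup.mem_normalizer_fintype (S := (Q : Set G)) fun q hq => by simpa using h q hq

lemma conj_inv_mem_of_mem_normalizer {g q : G} (hg : g ∈ normalizer Q) :
    g⁻¹ * q * g ∈ Q ↔ q ∈ Q :=
  (Subgroup.mem_normalizer_iff''.1 hg q).symm

lemma conj_mem_of_mem_normalizer {g q : G} (hg : g ∈ normalizer Q) :
    g * q * g⁻¹ ∈ Q ↔ q ∈ Q :=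
  (Subgroup.mem_normalizer_iff.1 hg q).symm

lemma conj_apply (h : normalizer Q) (σ : Representation K Q S) (q : Q) :
    conj h σ q = σ ⟨h * q * (h : G)⁻¹, (conj_mem_of_mem_normalizer h.2).2 q.2⟩ := rfl

lemma conj_conj (h k : normalizer Q) (σ : Representation K Q S) :
    conj k (conj h σ) = conj (h * k) σ := by
  ext q : 1
  simp only [conj_apply]
  congr 1
  ext
  simp [mul_assoc]

lemma conj_one (σ : Representation K Q S) : conj 1 σ = σ := by
  ext q : 1
  rw [conj_apply]
  congr 1
  ext
  simp

lemma IsSummand.conj {σ : Representation K Q S} {τ : Representation K Q T}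
    (h : IsSummand σ τ) (k : normalizer Q) :
    IsSummand (GreenTheory.conj k σ) (GreenTheory.conj k τ) := by
  rw [isSummand_iff] at *
  obtain ⟨i, p, h⟩ := h
  exact ⟨i, p, ⟨fun q s => h.incl.isIntertwining _ s⟩, ⟨fun q s => h.proj.isIntertwining _ s⟩,
    h.proj_incl⟩

lemma le_normalizer_self : Q ≤ normalizer Q := Subgroup.le_normalizer

lemma conjComap_normalizer_eq {g : G} (hg : g ∈ normalizer Q) :
    conjComap (normalizer Q).subtype Q g = Q.subgroupOf (normalizer Q) := by
  ext h
  rw [mem_conjComap, Subgroup.mem_subgroupOf]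
  exact conj_inv_mem_of_mem_normalizer hg

lemma IsVertex.indecomposable {ρ : Representation K G S} (hv : IsVertex Q ρ) :
    IsIndecomposable ρ :=
  hv.1

end Conj

/-! ### Vertices and sources. -/

section Source

variable {K G V S T : Type*} [Field K] [Group G] [Finite G] {Q : Subgroup G}
  [AddCommGroup V] [Module K V] [AddCommGroup S] [Module K S] [AddCommGroup T] [Module K T]

/-- An indecomposable direct summand `σ` of the restriction of `ρ` to `Q` such that `ρ` is a direct
summand of the module induced from `σ`. -/
structure IsSplitSource (Q : Subgroup G) (σ : Representation K Q S) (ρ : Representation K G V)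
    (i : S →ₗ[K] V) (p : V →ₗ[K] S) (a : V →ₗ[K] S) : Prop where
  indecomposable : IsIndecomposable σ
  retract : IsRetract σ (res Q ρ) i p
  intertwining : IsIntertwiningMap (res Q ρ) σ a
  relTr_eq : relTr ρ ρ Q (i ∘ₗ a) = LinearMap.id

variable {ρ : Representation K G V} {σ : Representation K Q S} {τ : Representation K Q T}

/-- If `β` has trace the identity, so does `e ∘ β` summed over the idempotents `e` of a
decomposition of the restriction to `Q`. By locality one indecomposable summand suffices. -/
lemma exists_isSplitSource (hρ : IsIndecomposable ρ) (hQ : IsTraceProjective Q ρ) :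
    ∃ (A : Subrepresentation (res Q ρ)) (p a : V →ₗ[K] A.toSubmodule),
      IsSplitSource Q A.toRepresentation ρ A.toSubmodule.subtype p a := by
  obtain ⟨β, hβ, h1⟩ := hQ
  have := hρ.1
  obtain ⟨A, p, hA, hr, hb⟩ := exists_indecomposable_isRetract (ρ := res Q ρ) hρ
    (relTr ρ ρ Q ∘ₗ LinearMap.lcomp K V β)
    (fun f hf => relTr_intertwining (hf.comp hβ)) (by
      change Function.Bijective (relTr ρ ρ Q (LinearMap.id ∘ₗ β))
      rw [LinearMap.id_comp, h1]
      exact Function.bijective_id)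
  change Function.Bijective (relTr ρ ρ Q ((A.toSubmodule.subtype ∘ₗ p) ∘ₗ β)) at hb
  obtain ⟨k, hk, h2, h3⟩ := (relTr_intertwining
    ((hr.incl.comp hr.proj).comp hβ)).exists_inverse hb
  refine ⟨A, p, p ∘ₗ β ∘ₗ k, hA, hr, hr.proj.comp (hβ.comp (hk.res Q)), ?_⟩
  rw [← LinearMap.comp_assoc, ← LinearMap.comp_assoc, ← relTr_comp hk]
  exact h3

lemma IsVertex.isTraceProjective (hv : IsVertex Q ρ) : IsTraceProjective Q ρ :=
  (isVertex_iff.1 hv).2.1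

variable {i : S →ₗ[K] V} {p a : V →ₗ[K] S}

/-- The vertex of a source is the whole group. -/
lemma IsSplitSource.eq_top (h : IsSplitSource Q σ ρ i p a) (hv : IsVertex Q ρ) {R : Subgroup Q}
    (hR : IsTraceProjective R σ) : R = ⊤ := by
  obtain ⟨γ, hγ, h1⟩ := hR
  have hle : R.map Q.subtype ≤ Q := Subgroup.map_subtype_le R
  have hsub : (R.map Q.subtype).subgroupOf Q = R := 
    Subgroup.comap_map_eq_self_of_injective Q.subtype_injective R
  have hint : IsIntertwiningMap (res R (res Q ρ)) (res R (res Q ρ)) (i ∘ₗ γ ∘ₗ a) :=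
    (h.retract.incl.res R).comp (hγ.comp (h.intertwining.res R))
  -- Transitivity of the trace makes `ρ` itself `R`-projective, so minimality of `Q` gives `R = Q`.
  have hproj : IsTraceProjective (R.map Q.subtype) ρ := by
    have hint' : IsIntertwiningMap (res (R.map Q.subtype) ρ) (res (R.map Q.subtype) ρ)
        (i ∘ₗ γ ∘ₗ a) := by
      refine ⟨?_⟩
      rintro ⟨_, q, hq, rfl⟩ v
      exact hint.isIntertwining ⟨q, hq⟩ v
    refine ⟨_, hint', ?_⟩
    rw [← relTr_trans hle hint', hsub, ← comp_relTr h.retract.incl,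
      ← relTr_comp h.intertwining, h1, LinearMap.id_comp, h.relTr_eq]
  have h2 := (isVertex_iff.1 hv).2.2 hproj hle
  rw [eq_top_iff]
  intro q _
  obtain ⟨q', hq', h3⟩ := h2 q.2
  rwa [← Subtype.ext h3]

/-- A source is, up to conjugation in the normalizer, a direct summand of each module `τ` such
that `ρ` is a direct summand of the module induced from `τ`. -/
lemma IsSplitSource.exists_isSummand_conj (h : IsSplitSource Q σ ρ i p a) (hv : IsVertex Q ρ)
    {b : V →ₗ[K] T} {c : T →ₗ[K] V} (hb : IsIntertwiningMap (res Q ρ) τ b)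
    (hc : IsIntertwiningMap τ (res Q ρ) c) (h1 : relTr ρ ρ Q (c ∘ₗ b) = LinearMap.id) :
    ∃ k : normalizer Q, IsSummand σ (conj k τ) := by
  obtain ⟨g, hg, hbij⟩ := exists_bijective_relTr_conjComap Q.subtype (hc.comp hb) h1
    h.indecomposable h.retract
  -- The source is projective relative to `Q ∩ gQg⁻¹`, so this is all of `Q` and `g` normalizes `Q`.
  -- The trace is then trivial, and the bijection `p ∘ (g c b g⁻¹) ∘ i` factors through a conjugate
  -- of `τ`.
  have htop := h.eq_top hv (isTraceProjective_of_bijective hg hbij)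
  rw [htop] at hg hbij
  have hgn : g ∈ normalizer Q := mem_normalizer_of_conj_inv_mem fun q hq => by
    have : (⟨q, hq⟩ : Q) ∈ conjComap Q.subtype Q g := htop ▸ Subgroup.mem_top _
    exact mem_conjComap.1 this
  have hg' : IsIntertwiningMap σ σ (p ∘ₗ linHom ρ ρ g (c ∘ₗ b) ∘ₗ i) :=
    ⟨fun q s => hg.isIntertwining ⟨q, Subgroup.mem_top q⟩ s⟩
  rw [relTr_top hg'] at hbij
  have key : ∀ (q : Q) (x : V), ρ g⁻¹ (ρ q x) = ρ (g⁻¹ * q * g) (ρ g⁻¹ x) := by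
    intro q x
    rw [← Module.End.mul_apply, ← Module.End.mul_apply, ← map_mul, ← map_mul]
    congr 2
    group
  have key' : ∀ (q : Q) (x : V), ρ g (ρ (g⁻¹ * q * g) x) = ρ q (ρ g x) := by
    intro q x
    rw [← Module.End.mul_apply, ← Module.End.mul_apply, ← map_mul, ← map_mul]
    congr 2
    group
  have hconj : ∀ q : Q, conj (⟨g, hgn⟩⁻¹ : normalizer Q) τ q =
      τ ⟨g⁻¹ * q * g, (conj_inv_mem_of_mem_normalizer hgn).2 q.2⟩ := by
    intro q
    rw [conj_apply]
    congr 1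
    ext
    simp
  refine ⟨⟨g, hgn⟩⁻¹, isSummand_iff.2 ⟨b ∘ₗ ρ g⁻¹ ∘ₗ i,
    isRetract_of_bijective (g := p ∘ₗ ρ g ∘ₗ c) ⟨fun q s => ?_⟩ ⟨fun q t => ?_⟩ ?_⟩⟩
  · have h2 : i (σ q s) = ρ q (i s) := h.retract.incl.isIntertwining q s
    rw [hconj]
    simp only [LinearMap.comp_apply, h2, key]
    exact hb.isIntertwining ⟨g⁻¹ * q * g, (conj_inv_mem_of_mem_normalizer hgn).2 q.2⟩ _
  · have h2 : c (τ ⟨g⁻¹ * q * g, (conj_inv_mem_of_mem_normalizer hgn).2 q.2⟩ t) =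
        ρ (g⁻¹ * q * g) (c t) := hc.isIntertwining _ t
    rw [hconj]
    simp only [LinearMap.comp_apply, h2, key']
    exact h.retract.proj.isIntertwining q _
  · exact hbij

/-- Sources are unique up to conjugation in the normalizer of the vertex. -/
lemma IsVertexSource.exists_isSummand_conj (hσ : IsVertexSource Q σ ρ)
    {b : V →ₗ[K] T} {c : T →ₗ[K] V} (hb : IsIntertwiningMap (res Q ρ) τ b)
    (hc : IsIntertwiningMap τ (res Q ρ) c) (h1 : relTr ρ ρ Q (c ∘ₗ b) = LinearMap.id) :
    ∃ k : normalizer Q, IsSummand (conj k σ) τ := by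
  obtain ⟨hv, hi, hs⟩ := hσ
  -- Both `σ` and `τ` are compared with one split source `A`: a conjugate of `A` is a summand of the
  -- indecomposable `σ`, hence isomorphic to it, and another conjugate is a summand of `τ`.
  obtain ⟨A, p, a, hA⟩ := exists_isSplitSource hv.indecomposable hv.isTraceProjective
  obtain ⟨b', c', hb', hc', h1'⟩ := isSummand_ind_iff.1 hs
  obtain ⟨k, hk⟩ := hA.exists_isSummand_conj hv hb' hc' h1'
  obtain ⟨l, hl⟩ := hA.exists_isSummand_conj hv hb hc h1
  have hk' : IsSummand (conj k⁻¹ A.toRepresentation) σ := by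
    have := hk.conj k⁻¹
    rwa [conj_conj, mul_inv_cancel, conj_one] at this
  obtain ⟨i, p, hr⟩ := isSummand_iff.1 hk'
  have := hA.indecomposable.2.1
  have hbij := hi.bijective_of_isRetract hr
  obtain ⟨e⟩ := hr.incl.toEquiv hbij
  have h2 : IsSummand σ (conj k⁻¹ A.toRepresentation) := isSummand_of_equiv e.symm
  have h3 : IsSummand (conj k σ) A.toRepresentation := by
    have := h2.conj k
    rwa [conj_conj, inv_mul_cancel, conj_one] at this
  refine ⟨k * l⁻¹, ?_⟩
  have h4 := (IsSummand.trans hl h3).conj l⁻¹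
  rwa [conj_conj, conj_conj, mul_inv_cancel, conj_one] at h4

/-- A vertex is contained in a conjugate of each subgroup relative to which the module is
projective. -/
lemma IsVertex.exists_conj_mem (hv : IsVertex Q ρ) {R : Subgroup G} (hR : IsTraceProjective R ρ) :
    ∃ g : G, ∀ q ∈ Q, g⁻¹ * q * g ∈ R := by
  obtain ⟨A, p, a, hA⟩ := exists_isSplitSource hv.indecomposable hv.isTraceProjective
  obtain ⟨g, hg⟩ := hR.exists_conjComap Q.subtype hA.indecomposable hA.retract
  refine ⟨g, fun q hq => ?_⟩
  have : (⟨q, hq⟩ : Q) ∈ conjComap Q.subtype R g := hA.eq_top hv hg ▸ Subgroup.mem_top _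
  exact mem_conjComap.1 this

end Source

/-! ### The Green correspondence. -/

section Green

variable {K G V T U : Type*} [Field K] [Group G] [Finite G] {Q : Subgroup G}
  [AddCommGroup V] [Module K V] [AddCommGroup T] [Module K T] [AddCommGroup U] [Module K U]
  {ρ : Representation K G V}

/-- The Green correspondent exists. -/
lemma IsVertex.exists_isGreenCorrespondent (hv : IsVertex Q ρ) :
    ∃ A : Subrepresentation (res (normalizer Q) ρ),
      IsGreenCorrespondent Q A.toRepresentation ρ := by
  obtain ⟨A, p, a, hA⟩ := exists_isSplitSource hv.indecomposable hv.isTraceProjective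
  have := hv.indecomposable.1
  set i := A.toSubmodule.subtype with hi
  let φ : (V →ₗ[K] V) →ₗ[K] (A.toSubmodule →ₗ[K] A.toSubmodule) :=
    { toFun := fun f => p ∘ₗ f ∘ₗ i
      map_add' := fun f g => by ext; simp
      map_smul' := fun c f => by ext; simp }
  have hres : ∀ {X : Type _} [AddCommGroup X] [Module K X]
      {π : Representation K (normalizer Q) X} {f : V →ₗ[K] X},
      IsIntertwiningMap (res (normalizer Q) ρ) π f → IsIntertwiningMap (res Q ρ)
        (π.comp (Subgroup.inclusion le_normalizer_self) : Representation K Q X) f :=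
    fun hf => ⟨fun q v => hf.isIntertwining (Subgroup.inclusion le_normalizer_self q) v⟩
  have hres' : ∀ {X : Type _} [AddCommGroup X] [Module K X]
      {π : Representation K (normalizer Q) X} {f : X →ₗ[K] V},
      IsIntertwiningMap π (res (normalizer Q) ρ) f → IsIntertwiningMap
        (π.comp (Subgroup.inclusion le_normalizer_self) : Representation K Q X) (res Q ρ) f :=
    fun hf => ⟨fun q v => hf.isIntertwining (Subgroup.inclusion le_normalizer_self q) v⟩
  -- Among the components of the restriction to `N_G(Q)`, choose `B` so that the split source `A` is
  -- a summand of its restriction to `Q`.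
  obtain ⟨B, pB, hB, hr, hb⟩ := exists_indecomposable_isRetract (ρ := res (normalizer Q) ρ)
    hA.indecomposable φ
    (fun f hf => hA.retract.proj.comp ((hres (π := res (normalizer Q) ρ) hf).comp hA.retract.incl))
    (by
      change Function.Bijective (p ∘ₗ LinearMap.id ∘ₗ i)
      rw [LinearMap.id_comp, hA.retract.proj_incl]
      exact Function.bijective_id)
  obtain ⟨p', hr'⟩ := isRetract_of_bijective (σ := A.toRepresentation) (f := pB ∘ₗ i)
    (g := p ∘ₗ B.toSubmodule.subtype) ((hres hr.proj).comp hA.retract.incl)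
    (hA.retract.proj.comp (hres' hr.incl)) hb
  -- If `B` is `R`-projective then so, up to conjugation, is its summand `A`, which admits no proper
  -- subgroup of `Q`. Hence `R` contains a conjugate of `Q`, which is `Q` itself by normality.
  have key : ∀ R : Subgroup (normalizer Q), IsTraceProjective R B.toRepresentation →
      ∃ h : normalizer Q, ∀ q : Q, h⁻¹ * Subgroup.inclusion le_normalizer_self q * h ∈ R := by
    intro R hR
    obtain ⟨h, hh⟩ := hR.exists_conjComap (Subgroup.inclusion le_normalizer_self)
      hA.indecomposable hr'
    refine ⟨h, fun q => ?_⟩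
    have : q ∈ conjComap (Subgroup.inclusion le_normalizer_self) R h :=
      hA.eq_top hv hh ▸ Subgroup.mem_top _
    exact mem_conjComap.1 this
  refine ⟨B, hv, isVertex_iff.2 ⟨hB, ?_, ?_⟩, isSummand_iff.2 ⟨_, _, hr⟩⟩
  · obtain ⟨g, hg⟩ := hv.isTraceProjective.exists_conjComap (normalizer Q).subtype hB hr
    obtain ⟨h, hh⟩ := key _ hg
    have hn : (h : G) * g ∈ normalizer Q := mem_normalizer_of_conj_inv_mem fun q hq => by
      have := mem_conjComap.1 (hh ⟨q, hq⟩)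
      simpa [mul_assoc] using this
    have hg' : g ∈ normalizer Q := by
      simpa using (Subgroup.mul_mem_cancel_left _ h.2).1 hn
    rwa [conjComap_normalizer_eq hg'] at hg
  · intro R hR _
    obtain ⟨h, hh⟩ := key R hR
    intro q hq
    rw [Subgroup.mem_subgroupOf] at hq
    have := hh ⟨h * q * (h : G)⁻¹, (conj_mem_of_mem_normalizer h.2).2 hq⟩
    convert this using 1
    ext
    simp [mul_assoc]

/-- The Green correspondent is a direct summand of each `Q`-projective module `π` such that `ρ` is
a direct summand of the module induced from `π`. -/
lemma IsGreenCorrespondent.isSummand {τ : Representation K (normalizer Q) U}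
    (hτ : IsGreenCorrespondent Q τ ρ) {π : Representation K (normalizer Q) T}
    (hπ : IsTraceProjective (Q.subgroupOf (normalizer Q)) π) {a : V →ₗ[K] T} {b : T →ₗ[K] V}
    (ha : IsIntertwiningMap (res (normalizer Q) ρ) π a)
    (hb : IsIntertwiningMap π (res (normalizer Q) ρ) b)
    (h1 : relTr ρ ρ (normalizer Q) (b ∘ₗ a) = LinearMap.id) : IsSummand τ π := by
  obtain ⟨hv, hvτ, hs⟩ := hτ
  obtain ⟨i, p, hr⟩ := isSummand_iff.1 hs
  obtain ⟨γ, hγ, hγ1⟩ := hπ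
  have hβ' : IsIntertwiningMap (res (Q.subgroupOf (normalizer Q)) (res (normalizer Q) ρ))
      (res (Q.subgroupOf (normalizer Q)) (res (normalizer Q) ρ)) (b ∘ₗ γ ∘ₗ a) :=
    (hb.res _).comp (hγ.comp (ha.res _))
  have hβ : IsIntertwiningMap (res Q ρ) (res Q ρ) (b ∘ₗ γ ∘ₗ a) :=
    ⟨fun q v => hβ'.isIntertwining ⟨⟨q, le_normalizer_self q.2⟩, q.2⟩ v⟩
  have hβ1 : relTr ρ ρ Q (b ∘ₗ γ ∘ₗ a) = LinearMap.id := by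
    rw [← relTr_trans le_normalizer_self hβ, ← comp_relTr hb, ← relTr_comp ha, hγ1,
      LinearMap.id_comp,
      h1]
  obtain ⟨g, hg, hbij⟩ := exists_bijective_relTr_conjComap (normalizer Q).subtype hβ hβ1
    hvτ.indecomposable hr
  -- `τ` is projective relative to `N_G(Q) ∩ gQg⁻¹`, so a conjugate of this group contains the
  -- vertex `Q` of `τ`; that forces `g` into the normalizer.
  have hgn : g ∈ normalizer Q := by
    obtain ⟨h, hh⟩ := hvτ.exists_conj_mem (isTraceProjective_of_bijective hg hbij)
    have hn : (h : G) * g ∈ normalizer Q := mem_normalizer_of_conj_inv_mem fun q hq => by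
      have := mem_conjComap.1 (hh ⟨q, le_normalizer_self hq⟩ (Subgroup.mem_subgroupOf.2 hq))
      simpa [mul_assoc] using this
    simpa using (Subgroup.mul_mem_cancel_left _ h.2).1 hn
  set R := conjComap (normalizer Q).subtype Q g with hR
  let g' : normalizer Q := ⟨g, hgn⟩
  have hγ' : IsIntertwiningMap (res R π) (res R π) (linHom π π g' γ) := by
    rw [isIntertwiningMap_res_iff]
    intro h hh
    have h2 : g'⁻¹ * h * g' ∈ Q.subgroupOf (normalizer Q) := mem_conjComap.1 hh
    have h3 := isIntertwiningMap_res_iff.1 hγ _ h2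
    conv_rhs => rw [← h3]
    rw [← Module.End.mul_apply, ← Module.End.mul_apply, ← map_mul, ← map_mul]
    congr 2
    group
  -- As `g` normalizes `Q`, conjugation by it passes through `a` and `b`, so the bijection on `τ`
  -- factors through `π`.
  have hlin : linHom ρ ρ g (b ∘ₗ γ ∘ₗ a) = b ∘ₗ linHom π π g' γ ∘ₗ a := by
    rw [linHom_comp ha, comp_linHom hb]
    exact (linHom_comp_hom (normalizer Q).subtype g' _).symm
  have hpa : IsIntertwiningMap τ π (a ∘ₗ i) := ha.comp hr.incl
  have hpb : IsIntertwiningMap π τ (p ∘ₗ b) := hr.proj.comp hb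
  have heq : p ∘ₗ linHom ρ ρ g (b ∘ₗ γ ∘ₗ a) ∘ₗ i = (p ∘ₗ b) ∘ₗ linHom π π g' γ ∘ₗ (a ∘ₗ i) := by
    rw [hlin]
    rfl
  rw [heq, ← comp_relTr hpb, ← relTr_comp hpa, ← LinearMap.comp_assoc] at hbij
  exact isSummand_iff.2 ⟨_, isRetract_of_bijective hpa (hpb.comp (relTr_intertwining hγ')) hbij⟩

instance {S : Type*} [AddCommGroup S] [Module K S] [FiniteDimensional K S]
    (σ : Representation K Q S) : FiniteDimensional K (IndV Q.subtype σ) := by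
  have : Module.Finite K (MonoidAlgebra K G) :=
    Module.Finite.equiv
      (MonoidAlgebra.coeffLinearEquiv K : MonoidAlgebra K G ≃ₗ[K] G →₀ K).symm
  exact Module.Finite.of_surjective _ (Coinvariants.mk_surjective _)

/-- A module is a direct summand of the module induced from its Green correspondent. -/
lemma IsGreenCorrespondent.exists_relTr_eq {τ : Representation K (normalizer Q) U}
    (hτ : IsGreenCorrespondent Q τ ρ) : ∃ (a : V →ₗ[K] U) (b : U →ₗ[K] V),
      IsIntertwiningMap (res (normalizer Q) ρ) τ a ∧
      IsIntertwiningMap τ (res (normalizer Q) ρ) b ∧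
      relTr ρ ρ (normalizer Q) (b ∘ₗ a) = LinearMap.id := by
  have hv := hτ.1
  obtain ⟨β, hβ, h1⟩ := hv.isTraceProjective
  have := hv.indecomposable.1
  let Q' := Q.subgroupOf (normalizer Q)
  let ρ' := res (normalizer Q) ρ
  let σ := res Q' ρ'
  have hβ' : IsIntertwiningMap (res Q' ρ') σ β := ⟨fun q v => hβ.isIntertwining ⟨q, q.2⟩ v⟩
  let A := relTr ρ' (ind Q' σ) Q' (IndV.mk Q'.subtype σ 1 ∘ₗ β)
  let B := relTr (ind Q' σ) ρ' Q' (LinearMap.id ∘ₗ indProj σ)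
  have hA : IsIntertwiningMap ρ' (ind Q' σ) A :=
    relTr_intertwining ((indMk_intertwining σ).comp hβ')
  have hB : IsIntertwiningMap (ind Q' σ) ρ' B :=
    relTr_intertwining (isIntertwiningMap_id.comp (indProj_intertwining σ))
  have hBA : relTr ρ ρ (normalizer Q) (B ∘ₗ A) = LinearMap.id := by
    rw [relTr_comp_relTr_ind hβ' LinearMap.id, LinearMap.id_comp,
      relTr_trans le_normalizer_self hβ, h1]
  -- `ρ` is a summand of the module obtained by inducing from `Q` to `N_G(Q)` and then to `G`. This
  -- functional finds an indecomposable summand `Y` of the intermediate module from which `ρ` is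
  -- still induced as a summand; `τ` is a summand of `Y`, hence isomorphic to it.
  let φ : (IndV Q'.subtype σ →ₗ[K] IndV Q'.subtype σ) →ₗ[K] (V →ₗ[K] V) :=
    relTr ρ ρ (normalizer Q) ∘ₗ
    { toFun := fun f => B ∘ₗ f ∘ₗ A
      map_add' := fun f g => by ext; simp
      map_smul' := fun c f => by ext; simp }
  obtain ⟨Y, p, hY, hr, hb⟩ := exists_indecomposable_isRetract (ρ := ind Q' σ)
    hv.indecomposable φ (fun f hf => relTr_intertwining (hB.comp (hf.comp hA))) (by
      change Function.Bijective (relTr ρ ρ (normalizer Q) (B ∘ₗ LinearMap.id ∘ₗ A))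
      rw [LinearMap.id_comp, hBA]
      exact Function.bijective_id)
  change Function.Bijective (relTr ρ ρ (normalizer Q)
    (B ∘ₗ (Y.toSubmodule.subtype ∘ₗ p) ∘ₗ A)) at hb
  obtain ⟨k, hk, h2, -⟩ := (relTr_intertwining
    (hB.comp ((hr.incl.comp hr.proj).comp hA))).exists_inverse hb
  rw [comp_relTr hk] at h2
  have hYproj : IsTraceProjective Q' Y.toRepresentation :=
    (isTraceProjective_ind (σ := σ)).of_isRetract hr
  obtain ⟨i, q, hiq⟩ := isSummand_iff.1 <| hτ.isSummand hYproj (a := p ∘ₗ A)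
    (b := k ∘ₗ B ∘ₗ Y.toSubmodule.subtype) (hr.proj.comp hA)
    ((hk.res _).comp (hB.comp hr.incl)) h2
  have := hτ.2.1.indecomposable.2.1
  have hbij := hY.bijective_of_isRetract hiq
  have hqi : i ∘ₗ q = LinearMap.id := by
    ext y : 1
    obtain ⟨x, rfl⟩ := hbij.2 y
    simp [hiq.proj_apply]
  refine ⟨q ∘ₗ p ∘ₗ A, (k ∘ₗ B ∘ₗ Y.toSubmodule.subtype) ∘ₗ i, hiq.proj.comp (hr.proj.comp hA),
    ((hk.res _).comp (hB.comp hr.incl)).comp hiq.incl, ?_⟩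
  rw [LinearMap.comp_assoc, ← LinearMap.comp_assoc (p ∘ₗ A), hqi, LinearMap.id_comp]
  exact h2

end Green

/-! ### Extension and restriction of scalars. -/

section BaseChange

variable {K : Type*} [Field K] (L : Type*) [Field L] [Algebra K L] {G : Type*} [Group G]
  {V U : Type*} [AddCommGroup V] [Module K V] [AddCommGroup U] [Module K U]
  {ρ : Representation K G V} {σ : Representation K G U}

lemma _root_.Representation.IsIntertwiningMap.baseChange {f : V →ₗ[K] U}
    (hf : IsIntertwiningMap ρ σ f) :
    IsIntertwiningMap (baseChange L ρ) (baseChange L σ) (f.baseChange L) :=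
  ⟨fun g x => by
    change f.baseChange L ((ρ g).baseChange L x) = (σ g).baseChange L (f.baseChange L x)
    rw [← LinearMap.comp_apply, ← LinearMap.comp_apply, ← LinearMap.baseChange_comp,
      ← LinearMap.baseChange_comp, hf.comp_eq]⟩

lemma linHom_baseChange (g : G) (f : V →ₗ[K] U) :
    linHom (baseChange L ρ) (baseChange L σ) g (f.baseChange L) =
      (linHom ρ σ g f).baseChange L := by
  rw [linHom_apply, linHom_apply, LinearMap.baseChange_comp, LinearMap.baseChange_comp]
  rfl

lemma relTr_baseChange [Finite G] (P : Subgroup G) (f : V →ₗ[K] U) :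
    relTr (baseChange L ρ) (baseChange L σ) P (f.baseChange L) =
      (relTr ρ σ P f).baseChange L := by
  let _ := Fintype.ofFinite (G ⧸ P)
  rw [relTr_apply, relTr_apply]
  simp only [linHom_baseChange]
  exact (map_sum (LinearMap.baseChangeHom K L V U) _ _).symm

lemma IsTraceProjective.baseChange [Finite G] {P : Subgroup G} (h : IsTraceProjective P ρ) :
    IsTraceProjective P (baseChange L ρ) := by
  obtain ⟨β, hβ, h1⟩ := h
  refine ⟨β.baseChange L, hβ.baseChange L, ?_⟩
  rw [relTr_baseChange, h1, LinearMap.baseChange_id]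

variable {L}

lemma baseChange_apply_tmul (g : G) (c : L) (v : V) :
    baseChange L ρ g (c ⊗ₜ[K] v) = c ⊗ₜ[K] ρ g v := rfl

lemma one_tmul_injective : Function.Injective fun v : V => (1 : L) ⊗ₜ[K] v :=
  Module.FaithfullyFlat.tensorProduct_mk_injective (A := K) (B := L) V

end BaseChange

section Restrict

variable (F : Type*) [Field F] {L : Type*} [Field L] [Algebra F L] {G : Type*} [Group G]
  {V U : Type*} [AddCommGroup V] [Module L V] [Module F V] [IsScalarTower F L V]
  [AddCommGroup U] [Module L U] [Module F U] [IsScalarTower F L U]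

/-- Restriction of scalars. -/
def restrictScalars (ρ : Representation L G V) : Representation F G V where
  toFun g := (ρ g).restrictScalars F
  map_one' := by ext; simp
  map_mul' g h := by ext; simp

variable {ρ : Representation L G V} {σ : Representation L G U}

lemma restrictScalars_apply (g : G) (v : V) : restrictScalars F ρ g v = ρ g v := rfl

lemma _root_.Representation.IsIntertwiningMap.restrictScalars {f : V →ₗ[L] U}
    (hf : IsIntertwiningMap ρ σ f) :
    IsIntertwiningMap (restrictScalars F ρ) (restrictScalars F σ) (f.restrictScalars F) :=
  ⟨hf.isIntertwining⟩

lemma IsTraceProjective.restrictScalars [Finite G] {P : Subgroup G} (h : IsTraceProjective P ρ) :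
    IsTraceProjective P (restrictScalars F ρ) := by
  obtain ⟨β, hβ, h1⟩ := h
  refine ⟨β.restrictScalars F, hβ.restrictScalars F, ?_⟩
  let _ := Fintype.ofFinite (G ⧸ P)
  ext v
  have := LinearMap.congr_fun h1 v
  rw [relTr_apply, LinearMap.sum_apply] at this ⊢
  exact this

end Restrict

/-! ### Simple modules. -/

section Simple

variable {K : Type*} [Field K] {G : Type*} [Group G] {V U : Type*} [AddCommGroup V] [Module K V]
  [AddCommGroup U] [Module K U] {ρ : Representation K G V} {σ : Representation K G U}

lemma nontrivial_of_isIrreducible (h : ρ.IsIrreducible) : Nontrivial V := by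
  by_contra hn
  rw [not_nontrivial_iff_subsingleton] at hn
  obtain ⟨A, B, hAB⟩ := h.toNontrivial
  apply hAB
  apply Subrepresentation.toSubmodule_injective
  exact Subsingleton.elim _ _

lemma isIrreducible_iff : ρ.IsIrreducible ↔ Nontrivial V ∧
    ∀ A : Subrepresentation ρ, A.toSubmodule = ⊥ ∨ A.toSubmodule = ⊤ := by
  constructor
  · intro h
    refine ⟨nontrivial_of_isIrreducible h, fun A => ?_⟩
    rcases h.eq_bot_or_eq_top A with rfl | rfl
    · exact Or.inl rfl
    · exact Or.inr rfl
  · rintro ⟨hn, h⟩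
    refine { exists_pair_ne := ⟨⊥, ⊤, fun he => ?_⟩, eq_bot_or_eq_top := fun A => ?_ }
    · exact bot_ne_top (α := Submodule K V) (congrArg Subrepresentation.toSubmodule he)
    · exact (h A).imp (fun h => Subrepresentation.toSubmodule_injective h)
        fun h => Subrepresentation.toSubmodule_injective h

lemma injective_of_isIrreducible (h : σ.IsIrreducible) {f : U →ₗ[K] V}
    (hf : IsIntertwiningMap σ ρ f) (h0 : f ≠ 0) : Function.Injective f := by
  rw [← LinearMap.ker_eq_bot]
  refine ((isIrreducible_iff.1 h).2 ⟨LinearMap.ker f, fun g v hv => ?_⟩).resolve_right fun h' =>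
    h0 (LinearMap.ker_eq_top.1 h')
  rw [LinearMap.mem_ker] at hv ⊢
  rw [hf.isIntertwining, hv, map_zero]

lemma isIrreducible_of_equiv (h : ρ.IsIrreducible) (e : ρ.Equiv σ) : σ.IsIrreducible := by
  rw [isIrreducible_iff] at *
  obtain ⟨hn, h⟩ := h
  refine ⟨e.toLinearEquiv.symm.toEquiv.nontrivial, fun A => ?_⟩
  have hA := h ⟨A.toSubmodule.comap e.toLinearEquiv.toLinearMap, fun g v hv => by
    have h4 : e.toLinearMap (ρ g v) = σ g (e.toLinearMap v) :=
      e.toIntertwiningMap.isIntertwining _ _ g v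
    rw [Submodule.mem_comap]
    exact h4 ▸ A.apply_mem_toSubmodule g hv⟩
  have hs : Function.Surjective e.toLinearEquiv.toLinearMap := e.toLinearEquiv.surjective
  refine hA.imp (fun hA => ?_) fun hA => ?_
  · apply Submodule.comap_injective_of_surjective hs
    change A.toSubmodule.comap e.toLinearEquiv.toLinearMap = ⊥ at hA
    rw [hA, Submodule.comap_bot, eq_comm, LinearMap.ker_eq_bot]
    exact e.toLinearEquiv.injective
  · apply Submodule.comap_injective_of_surjective hs
    change A.toSubmodule.comap e.toLinearEquiv.toLinearMap = ⊤ at hA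
    rw [hA, Submodule.comap_top]

/-- A module over a finite group has a nonzero finite dimensional submodule. -/
lemma exists_finiteDimensional_subrepresentation [Finite G] [Nontrivial V] :
    ∃ A : Subrepresentation ρ, FiniteDimensional K A.toSubmodule ∧ A ≠ ⊥ := by
  obtain ⟨x, hx⟩ := exists_ne (0 : V)
  refine ⟨⟨Submodule.span K (Set.range fun g => ρ g x), fun g v hv => ?_⟩,
    FiniteDimensional.span_of_finite K (Set.finite_range _), fun h => hx ?_⟩
  · have : Submodule.span K (Set.range fun g => ρ g x) ≤
        (Submodule.span K (Set.range fun g => ρ g x)).comap (ρ g) := by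
      rw [Submodule.span_le]
      rintro _ ⟨k, rfl⟩
      refine Submodule.subset_span ⟨g * k, ?_⟩
      simp
    exact this hv
  · have h' : Submodule.span K (Set.range fun g => ρ g x) = ⊥ :=
      congrArg Subrepresentation.toSubmodule h
    rw [Submodule.span_eq_bot] at h'
    simpa using h' (ρ 1 x) ⟨1, rfl⟩

lemma finiteDimensional_of_isIrreducible [Finite G] (h : ρ.IsIrreducible) :
    FiniteDimensional K V := by
  have := nontrivial_of_isIrreducible h
  obtain ⟨A, hA, h0⟩ := exists_finiteDimensional_subrepresentation (ρ := ρ)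
  have := ((isIrreducible_iff.1 h).2 A).resolve_left
    fun h => h0 (Subrepresentation.toSubmodule_injective h)
  rw [this] at hA
  exact Module.finite_def.2 (Module.Finite.iff_fg.1 hA)

lemma isIndecomposable_of_isIrreducible [Finite G] (h : ρ.IsIrreducible) : IsIndecomposable ρ := by
  refine ⟨finiteDimensional_of_isIrreducible h, nontrivial_of_isIrreducible h, fun A B hAB => ?_⟩
  rcases h.eq_bot_or_eq_top A with hA | hA
  · exact Or.inl hA
  · right
    rw [hA] at hAB
    exact eq_bot_of_top_isCompl hAB

/-- A nonzero module over a finite group has a simple submodule. -/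
lemma exists_isIrreducible_subrepresentation [Finite G] [Nontrivial V] :
    ∃ A : Subrepresentation ρ, A.toRepresentation.IsIrreducible := by
  classical
  let P : ℕ → Prop := fun n => ∃ A : Subrepresentation ρ, FiniteDimensional K A.toSubmodule ∧
    A ≠ ⊥ ∧ Module.finrank K A.toSubmodule = n
  have hP : ∃ n, P n := by
    obtain ⟨A, h1, h2⟩ := exists_finiteDimensional_subrepresentation (ρ := ρ)
    exact ⟨_, A, h1, h2, rfl⟩
  obtain ⟨A, hfd, h0, hn⟩ := Nat.find_spec hP
  refine ⟨A, isIrreducible_iff.2 ⟨?_, fun B => ?_⟩⟩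
  · rw [Submodule.nontrivial_iff_ne_bot]
    exact fun h => h0 (Subrepresentation.toSubmodule_injective h)
  · by_cases hB : B.toSubmodule = ⊥
    · exact Or.inl hB
    · right
      let D : Subrepresentation ρ := ⟨B.toSubmodule.map A.toSubmodule.subtype, by
        rintro g _ ⟨v, hv, rfl⟩
        exact ⟨_, B.apply_mem_toSubmodule g hv, rfl⟩⟩
      let e : B.toSubmodule ≃ₗ[K] D.toSubmodule :=
        Submodule.equivMapOfInjective _ A.toSubmodule.injective_subtype B.toSubmodule
      have hD : P (Module.finrank K D.toSubmodule) := by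
        refine ⟨D, Module.Finite.equiv e, fun h => hB ?_, rfl⟩
        have h' : B.toSubmodule.map A.toSubmodule.subtype = ⊥ :=
          congrArg Subrepresentation.toSubmodule h
        exact Submodule.map_injective_of_injective A.toSubmodule.injective_subtype
          (h'.trans (Submodule.map_bot _).symm)
      have h3 := Nat.find_min' hP hD
      rw [← hn, ← e.finrank_eq] at h3
      exact Submodule.eq_top_of_finrank_eq (le_antisymm (Submodule.finrank_le _) h3)

/-- A nonzero finite dimensional module has a simple quotient. -/
lemma exists_isIrreducible_quotient [FiniteDimensional K V] [Nontrivial V] :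
    ∃ (A : Submodule K V) (τ : Representation K G (V ⧸ A)), τ.IsIrreducible ∧
      IsIntertwiningMap ρ τ A.mkQ := by
  classical
  let P : ℕ → Prop := fun n => ∃ A : Subrepresentation ρ,
    A ≠ ⊤ ∧ Module.finrank K (V ⧸ A.toSubmodule) = n
  have hP : ∃ n, P n := by
    refine ⟨_, ⊥, fun h => ?_, rfl⟩
    exact bot_ne_top (α := Submodule K V) (congrArg Subrepresentation.toSubmodule h)
  obtain ⟨A, h0, hn⟩ := Nat.find_spec hP
  refine ⟨A.toSubmodule, ρ.quotient A.toSubmodule fun g v hv => A.apply_mem_toSubmodule g hv,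
    isIrreducible_iff.2 ⟨?_, fun B => ?_⟩, ⟨fun g v => rfl⟩⟩
  · rw [Submodule.Quotient.nontrivial_iff]
    exact fun h => h0 (Subrepresentation.toSubmodule_injective h)
  · by_cases hB : B.toSubmodule = ⊤
    · exact Or.inr hB
    · left
      let D : Subrepresentation ρ := ⟨B.toSubmodule.comap A.toSubmodule.mkQ, fun g v hv =>
        B.apply_mem_toSubmodule g hv⟩
      have hD : P (Module.finrank K (V ⧸ D.toSubmodule)) := by
        refine ⟨D, fun h => hB ?_, rfl⟩
        have h' : B.toSubmodule.comap A.toSubmodule.mkQ = ⊤ :=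
          congrArg Subrepresentation.toSubmodule h
        rw [← Submodule.map_comap_eq_of_surjective A.toSubmodule.mkQ_surjective B.toSubmodule, h',
          Submodule.map_top, Submodule.range_mkQ]
      have h3 := Nat.find_min' hP hD
      have h4 : A.toSubmodule ≤ D.toSubmodule := A.toSubmodule.le_comap_mkQ B.toSubmodule
      have h5 := Submodule.finrank_quotient_add_finrank A.toSubmodule
      have h6 := Submodule.finrank_quotient_add_finrank D.toSubmodule
      have h7 : A.toSubmodule = D.toSubmodule :=
        Submodule.eq_of_le_of_finrank_le h4 (by omega)
      rw [← Submodule.map_comap_eq_of_surjective A.toSubmodule.mkQ_surjective B.toSubmodule]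
      change D.toSubmodule.map _ = ⊥
      rw [← h7]
      exact Submodule.mkQ_map_self _

/-- A module is simple if some extension of scalars is. -/
lemma isIrreducible_of_baseChange {L : Type*} [Field L] [Algebra K L]
    (h : (baseChange L ρ).IsIrreducible) : ρ.IsIrreducible := by
  obtain ⟨hn, h⟩ := isIrreducible_iff.1 h
  refine isIrreducible_iff.2 ⟨?_, fun A => ?_⟩
  · by_contra hV
    rw [not_nontrivial_iff_subsingleton] at hV
    exact not_subsingleton (L ⊗[K] V) inferInstance
  · have hint : IsIntertwiningMap (baseChange L A.toRepresentation) (baseChange L ρ)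
        (A.toSubmodule.subtype.baseChange L) := IsIntertwiningMap.baseChange L ⟨fun g v => rfl⟩
    rcases h ⟨LinearMap.range (A.toSubmodule.subtype.baseChange L), by
        rintro g _ ⟨v, rfl⟩
        exact ⟨_, hint.isIntertwining g v⟩⟩ with h | h
    · left
      change LinearMap.range (A.toSubmodule.subtype.baseChange L) = ⊥ at h
      rw [eq_bot_iff]
      intro a ha
      have h1 : (1 : L) ⊗ₜ[K] a ∈ LinearMap.range (A.toSubmodule.subtype.baseChange L) :=
        ⟨1 ⊗ₜ ⟨a, ha⟩, rfl⟩
      rw [h, Submodule.mem_bot] at h1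
      exact one_tmul_injective (L := L) (h1.trans (TensorProduct.tmul_zero V (1 : L)).symm)
    · right
      change LinearMap.range (A.toSubmodule.subtype.baseChange L) = ⊤ at h
      rw [eq_top_iff]
      intro v _
      obtain ⟨y, hy⟩ : (1 : L) ⊗ₜ[K] v ∈ LinearMap.range (A.toSubmodule.subtype.baseChange L) :=
        h ▸ Submodule.mem_top
      -- Membership of `v` in `A` is tested in the quotient, where `1 ⊗ v` vanishes only if `v`
      -- does.
      have h1 : (A.toSubmodule.mkQ.baseChange L) (1 ⊗ₜ v) = 0 := by
        rw [← hy, ← LinearMap.comp_apply, ← LinearMap.baseChange_comp]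
        have : A.toSubmodule.mkQ ∘ₗ A.toSubmodule.subtype = 0 := by
          ext x
          simp
        rw [this, LinearMap.baseChange_zero, LinearMap.zero_apply]
      rw [LinearMap.baseChange_tmul] at h1
      have h2 := one_tmul_injective (L := L)
        (h1.trans (TensorProduct.tmul_zero _ (1 : L)).symm)
      exact (Submodule.Quotient.mk_eq_zero _).1 h2

end Simple

section Finite

variable (K : Type*) [Field K] (G : Type*) [Group G] [Finite G]

/-- A simple module embeds into the regular module. -/
lemma exists_injective_leftRegular {V : Type*} [AddCommGroup V] [Module K V]
    {ρ : Representation K G V} (h : ρ.IsIrreducible) :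
    ∃ f : V →ₗ[K] MonoidAlgebra K G, IsIntertwiningMap ρ (leftRegular K G) f ∧
      Function.Injective f := by
  let _ := Fintype.ofFinite G
  have := nontrivial_of_isIrreducible h
  obtain ⟨x, hx⟩ := exists_ne (0 : V)
  obtain ⟨φ, hφ⟩ : ∃ φ : Module.Dual K V, φ x ≠ 0 := by
    by_contra hc
    push Not at hc
    exact hx ((Module.forall_dual_apply_eq_zero_iff K x).1 hc)
  -- The `G`-map attached to the functional `φ`; its coefficient at `1` is `φ`, so it does not kill
  -- `x`.
  let f : V →ₗ[K] MonoidAlgebra K G :=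
    ∑ g : G, (MonoidAlgebra.lsingle g : K →ₗ[K] MonoidAlgebra K G) ∘ₗ φ ∘ₗ ρ g⁻¹
  have hf : ∀ v, f v = ∑ g : G, MonoidAlgebra.single g (φ (ρ g⁻¹ v)) := by
    intro v
    simp [f]
  have hint : IsIntertwiningMap ρ (leftRegular K G) f := by
    refine ⟨fun k v => ?_⟩
    rw [hf, hf, map_sum]
    refine Fintype.sum_equiv (Equiv.mulLeft k⁻¹) _ _ fun g => ?_
    simp [← Module.End.mul_apply, ← map_mul]
  refine ⟨f, hint, injective_of_isIrreducible h hint fun h0 => hφ ?_⟩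
  have h1 := LinearMap.congr_fun h0 x
  rw [hf] at h1
  have h2 := congrArg (fun a => MonoidAlgebra.coeff a 1) h1
  classical
  simpa [Finsupp.single_apply, MonoidAlgebra.coeff_single] using h2

end Finite

/-! ### Occurrence of a module over a subfield. -/

section Occurs

variable {F L G W M : Type*} [Field F] [Field L] [Algebra F L] [Group G]
  [AddCommGroup W] [Module F W] [AddCommGroup M] [Module L M]

/-- There is a nonzero homomorphism from the `FG`-module `σ` to the `LG`-module `ρ`. -/
def Occurs (σ : Representation F G W) (ρ : Representation L G M) : Prop :=
  ∃ f : L ⊗[F] W →ₗ[L] M, IsIntertwiningMap (baseChange L σ) ρ f ∧ f ≠ 0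

variable {σ : Representation F G W} {ρ : Representation L G M}

/-- Extension of scalars is left adjoint to restriction. -/
lemma occurs_iff [Module F M] [IsScalarTower F L M] : Occurs σ ρ ↔
    ∃ f : W →ₗ[F] M, IsIntertwiningMap σ (restrictScalars F ρ) f ∧ f ≠ 0 := by
  constructor
  · rintro ⟨f, hf, h0⟩
    refine ⟨f.restrictScalars F ∘ₗ TensorProduct.mk F L W 1, ⟨fun g w => ?_⟩, fun h => h0 ?_⟩
    · exact hf.isIntertwining g (1 ⊗ₜ w)
    · ext w
      exact LinearMap.congr_fun h w
  · rintro ⟨f, hf, h0⟩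
    refine ⟨f.liftBaseChange L, ⟨fun g x => ?_⟩, fun h => h0 ?_⟩
    · induction x using TensorProduct.induction_on with
      | zero => simp
      | tmul c w =>
        rw [baseChange_apply_tmul, LinearMap.liftBaseChange_tmul, LinearMap.liftBaseChange_tmul,
          hf.isIntertwining, map_smul]
        rfl
      | add x y hx hy => simp only [map_add, hx, hy]
    · ext w
      simpa using LinearMap.congr_fun h (1 ⊗ₜ w)

lemma Occurs.of_equiv {W' : Type*} [AddCommGroup W'] [Module F W'] {σ' : Representation F G W'}
    (h : Occurs σ ρ) (e : σ'.Equiv σ) : Occurs σ' ρ := by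
  obtain ⟨f, hf, h0⟩ := h
  refine ⟨f ∘ₗ (e.toLinearMap).baseChange L,
    hf.comp ((isRetract_of_equiv e).incl.baseChange L), fun h => h0 ?_⟩
  have h1 : (e.toLinearMap).baseChange L ∘ₗ (e.symm.toLinearMap).baseChange L = LinearMap.id := by
    rw [← LinearMap.baseChange_comp, ← LinearMap.baseChange_id]
    exact congrArg _ (LinearMap.ext fun x => e.toLinearEquiv.apply_symm_apply x)
  rw [← LinearMap.comp_id f, ← h1, ← LinearMap.comp_assoc, h, LinearMap.zero_comp]

lemma Occurs.comp {M' : Type*} [AddCommGroup M'] [Module L M'] {ρ' : Representation L G M'}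
    (h : Occurs σ ρ) {f : M →ₗ[L] M'} (hf : IsIntertwiningMap ρ ρ' f)
    (hi : Function.Injective f) : Occurs σ ρ' := by
  obtain ⟨k, hk, h0⟩ := h
  refine ⟨f ∘ₗ k, hf.comp hk, fun h => h0 ?_⟩
  exact LinearMap.ext fun x => hi (by simpa using LinearMap.congr_fun h x)

lemma Occurs.baseChange {E : Type*} [Field E] [Algebra F E] [Algebra L E] [IsScalarTower F L E]
    (h : Occurs σ ρ) : Occurs σ (baseChange E ρ) := by
  obtain ⟨f, hf, h0⟩ := h
  let c := TensorProduct.AlgebraTensorModule.cancelBaseChange F L E E W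
  have hc : IsIntertwiningMap (GreenTheory.baseChange E (GreenTheory.baseChange L σ))
      (GreenTheory.baseChange E σ) (c : _ →ₗ[E] _) := by
    refine ⟨fun g x => ?_⟩
    suffices h : (c : _ →ₗ[E] _) ∘ₗ
        (GreenTheory.baseChange E (GreenTheory.baseChange L σ)) g =
        (GreenTheory.baseChange E σ) g ∘ₗ (c : _ →ₗ[E] _) from LinearMap.congr_fun h x
    ext w
    simp [c, baseChange_apply_tmul]
  refine ⟨f.baseChange E ∘ₗ c.symm, (hf.baseChange E).comp hc.symm, fun h => h0 ?_⟩
  refine LinearMap.ext fun x => ?_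
  have h1 := LinearMap.congr_fun h (c (1 ⊗ₜ x))
  rw [LinearMap.comp_apply, LinearEquiv.coe_coe, LinearEquiv.symm_apply_apply,
    LinearMap.baseChange_tmul, LinearMap.zero_apply] at h1
  simpa using one_tmul_injective (L := E) (h1.trans (TensorProduct.tmul_zero _ (1 : E)).symm)

lemma occurs_of_isSummand {U : Type*} [AddCommGroup U] [Module L U] {τ : Representation L G U}
    [Nontrivial U] (h : IsSummand τ (baseChange L σ)) : Occurs σ τ := by
  obtain ⟨i, p, hr⟩ := isSummand_iff.1 h
  refine ⟨p, hr.proj, fun h => ?_⟩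
  obtain ⟨x, hx⟩ := exists_ne (0 : U)
  exact hx (by rw [← hr.proj_apply x, h, LinearMap.zero_apply])

/-- Each module has a simple constituent over a subfield. -/
lemma exists_isIrreducible_occurs (F : Type*) [Field F] [Algebra F L] [Module F M]
    [IsScalarTower F L M] [Finite G] [Nontrivial M] (ρ : Representation L G M) :
    ∃ A : Subrepresentation (restrictScalars F ρ), A.toRepresentation.IsIrreducible ∧
      Occurs A.toRepresentation ρ := by
  obtain ⟨A, hA⟩ := exists_isIrreducible_subrepresentation (ρ := restrictScalars F ρ)
  refine ⟨A, hA, occurs_iff.2 ⟨A.toSubmodule.subtype, ⟨fun g x => rfl⟩, fun h => ?_⟩⟩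
  have := nontrivial_of_isIrreducible hA
  obtain ⟨x, hx⟩ := exists_ne (0 : A.toSubmodule)
  exact hx (Subtype.ext (LinearMap.congr_fun h x))

end Occurs

/-! ### Restriction of a simple module is isotypic. -/

section Isotypic

variable {F L G W M : Type*} [Field F] [Field L] [Algebra F L] [Group G]
  [AddCommGroup W] [Module F W] [AddCommGroup M] [Module L M]
  {σ : Representation F G W} {ρ : Representation L G M}

/-- An equivariant map as a homomorphism of modules over the group algebra. -/
noncomputable def toAsModule {V U : Type*} [AddCommGroup V] [Module F V] [AddCommGroup U]
    [Module F U] {ρ : Representation F G V} {τ : Representation F G U} {f : V →ₗ[F] U}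
    (hf : IsIntertwiningMap ρ τ f) : ρ.asModule →ₗ[MonoidAlgebra F G] τ.asModule :=
  IntertwiningMap.equivLinearMapAsModule ρ τ ⟨f, hf.comp_eq⟩

lemma exists_isIntertwiningMap_of_asModule {V U : Type*} [AddCommGroup V] [Module F V]
    [AddCommGroup U] [Module F U] {ρ : Representation F G V} {τ : Representation F G U}
    (f : ρ.asModule →ₗ[MonoidAlgebra F G] τ.asModule) :
    ∃ k : V →ₗ[F] U, IsIntertwiningMap ρ τ k ∧ ∀ v : V, k v = f v :=
  ⟨_, isIntertwiningMap_of_intertwiningMap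
    ((IntertwiningMap.equivLinearMapAsModule ρ τ).symm f), fun _ => rfl⟩

lemma nonempty_equiv_of_asModule {V U : Type*} [AddCommGroup V] [Module F V]
    [AddCommGroup U] [Module F U] {ρ : Representation F G V} {τ : Representation F G U}
    (e : ρ.asModule ≃ₗ[MonoidAlgebra F G] τ.asModule) : Nonempty (ρ.Equiv τ) := by
  obtain ⟨k, hk, hke⟩ := exists_isIntertwiningMap_of_asModule e.toLinearMap
  refine hk.toEquiv ?_
  rw [show (k : V → U) = e from funext hke]
  exact e.bijective

variable [Module F M] [IsScalarTower F L M]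

/-- A simple module is isotypic over a subfield. -/
lemma isotypicComponent_eq_top (hρ : ρ.IsIrreducible) (hσ : σ.IsIrreducible)
    (h : Occurs σ ρ) :
    isotypicComponent (MonoidAlgebra F G) (restrictScalars F ρ).asModule σ.asModule = ⊤ := by
  obtain ⟨f, hf, h0⟩ := occurs_iff.1 h
  have hfi := injective_of_isIrreducible hσ hf h0
  set N := isotypicComponent (MonoidAlgebra F G) (restrictScalars F ρ).asModule σ.asModule with hN
  have hinv := Submodule.IsFullyInvariant.isotypicComponent (MonoidAlgebra F G)
    (restrictScalars F ρ).asModule σ.asModule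
  have hle : LinearMap.range (toAsModule hf) ≤ N :=
    le_sSup ⟨(LinearEquiv.ofInjective (toAsModule hf) hfi).symm⟩
  let N' := Subrepresentation.ofSubmodule' N
  -- Multiplication by `c` is an `FG`-endomorphism and an isotypic component is fully invariant, so
  -- the component is an `LG`-submodule of the simple module `M`.
  have hsmul : ∀ (c : L) (x : M), x ∈ N'.toSubmodule → c • x ∈ N'.toSubmodule := by
    intro c x hx
    have hc : IsIntertwiningMap (restrictScalars F ρ) (restrictScalars F ρ)
        ((c • LinearMap.id : M →ₗ[L] M).restrictScalars F) :=
      ⟨fun g v => by simp [restrictScalars_apply]⟩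
    exact hinv (toAsModule hc) hx
  let A : Subrepresentation ρ :=
    ⟨{ N'.toSubmodule.toAddSubmonoid with smul_mem' := fun c x hx => hsmul c x hx },
      fun g v hv => N'.apply_mem_toSubmodule g hv⟩
  have hA : A.toSubmodule = ⊤ := by
    refine ((isIrreducible_iff.1 hρ).2 A).resolve_left fun h1 => h0 ?_
    ext w
    have : f w ∈ A.toSubmodule := hle ⟨w, rfl⟩
    rw [h1, Submodule.mem_bot] at this
    exact this
  have hall : ∀ x : M, x ∈ A.toSubmodule := fun x => hA ▸ Submodule.mem_top
  exact eq_top_iff.2 fun x _ => hall x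

lemma isSemisimpleModule_restrictScalars (hρ : ρ.IsIrreducible) (hσ : σ.IsIrreducible)
    (h : Occurs σ ρ) :
    IsSemisimpleModule (MonoidAlgebra F G) (restrictScalars F ρ).asModule := by
  have h1 := isotypicComponent_eq_top hρ hσ h
  have := (irreducible_iff_isSimpleModule_asModule σ).1 hσ
  have h2 : IsSemisimpleModule (MonoidAlgebra F G)
    (isotypicComponent (MonoidAlgebra F G) (restrictScalars F ρ).asModule σ.asModule) :=
    inferInstance
  rw [h1] at h2
  exact IsSemisimpleModule.congr Submodule.topEquiv.symm

lemma isIsotypicOfType_restrictScalars (hρ : ρ.IsIrreducible) (hσ : σ.IsIrreducible)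
    (h : Occurs σ ρ) :
    IsIsotypicOfType (MonoidAlgebra F G) (restrictScalars F ρ).asModule σ.asModule := by
  have := (irreducible_iff_isSimpleModule_asModule σ).1 hσ
  exact IsIsotypicOfType.of_isotypicComponent_eq_top (isotypicComponent_eq_top hρ hσ h)

lemma exists_isRetract_restrictScalars (hρ : ρ.IsIrreducible) (hσ : σ.IsIrreducible)
    (h : Occurs σ ρ) : ∃ i p, IsRetract σ (restrictScalars F ρ) i p := by
  have := isSemisimpleModule_restrictScalars hρ hσ h
  obtain ⟨f, hf, h0⟩ := occurs_iff.1 h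
  obtain ⟨q, hq⟩ := IsSemisimpleModule.extension_property (toAsModule hf)
    (injective_of_isIrreducible hσ hf h0) LinearMap.id
  obtain ⟨p, hp, hpq⟩ := exists_isIntertwiningMap_of_asModule q
  refine ⟨f, p, hf, hp, ?_⟩
  ext w
  exact (hpq (f w)).trans (LinearMap.congr_fun hq w)

end Isotypic

section Unique

variable {F L G W M : Type*} [Field F] [Field L] [Algebra F L] [Group G]
  [AddCommGroup W] [Module F W] [AddCommGroup M] [Module L M]
  {σ : Representation F G W} {ρ : Representation L G M}

/-- The simple constituent of a simple module over a subfield is unique. -/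
lemma Occurs.unique {W' : Type*} [AddCommGroup W'] [Module F W'] {σ' : Representation F G W'}
    (hρ : ρ.IsIrreducible) (hσ : σ.IsIrreducible) (hσ' : σ'.IsIrreducible) (h : Occurs σ ρ)
    (h' : Occurs σ' ρ) : Nonempty (σ'.Equiv σ) := by
  let _ : Module F M := Module.compHom M (algebraMap F L)
  have : IsScalarTower F L M := IsScalarTower.of_algebraMap_smul fun _ _ => rfl
  obtain ⟨f, hf, h0⟩ := occurs_iff.1 h'
  have hfi := injective_of_isIrreducible hσ' hf h0
  have := (irreducible_iff_isSimpleModule_asModule σ').1 hσ'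
  let e := LinearEquiv.ofInjective (toAsModule hf) hfi
  have := IsSimpleModule.congr e.symm
  obtain ⟨e'⟩ := isIsotypicOfType_restrictScalars hρ hσ h (LinearMap.range (toAsModule hf))
  exact nonempty_equiv_of_asModule (e.trans e')

end Unique

/-! ### Finite separable extensions. -/

section Separable

variable {F K G W V : Type*} [Field F] [Field K] [Algebra F K] [Group G]
  [AddCommGroup W] [Module F W] [AddCommGroup V] [Module K V]

/-- Naturality of the splitting of `K ⊗ V → V` given by the separability element. For `f = ρ g` it
says that the splitting is equivariant. -/
lemma sec_map {V' : Type*} [AddCommGroup V'] [Module K V'] [Module F V] [IsScalarTower F K V]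
    [Module F V'] [IsScalarTower F K V'] [Algebra.FormallyUnramified F K]
    [Algebra.EssFiniteType F K] (f : V →ₗ[K] V') (v : V) :
    Algebra.FormallyUnramified.sec F K V' (f v) =
      (f.restrictScalars F).baseChange K (Algebra.FormallyUnramified.sec F K V v) := by
  simp only [Algebra.FormallyUnramified.sec, LinearMap.coe_mk, LinearMap.coe_toAddHom,
    LinearMap.comp_apply, LinearMap.flip_apply,
    TensorProduct.AlgebraTensorModule.mapBilinear_apply]
  induction Algebra.FormallyUnramified.elem F K using TensorProduct.induction_on with
  | zero => simp
  | tmul r s => simp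
  | add x y hx hy => simp only [map_add, hx, hy]

/-- A simple module over a finite separable extension `K` of `F` is a direct summand of `K ⊗ σ`,
where `σ` is its simple constituent over `F`. -/
lemma Occurs.isSummand [FiniteDimensional F K] [Algebra.IsSeparable F K] [Finite G]
    {σ : Representation F G W} {ρ : Representation K G V}
    (hρ : ρ.IsIrreducible) (hσ : σ.IsIrreducible) (h : Occurs σ ρ) :
    IsSummand ρ (GreenTheory.baseChange K σ) := by
  let _ : Module F V := Module.compHom V (algebraMap F K)
  have : IsScalarTower F K V := IsScalarTower.of_algebraMap_smul fun _ _ => rfl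
  have := isSemisimpleModule_restrictScalars hρ hσ h
  have := (irreducible_iff_isSimpleModule_asModule σ).1 hσ
  have hiso := isIsotypicOfType_restrictScalars hρ hσ h
  have := finiteDimensional_of_isIrreducible hρ
  have : Module.Finite F V := Module.Finite.trans K V
  have : Module.Finite (MonoidAlgebra F G) (restrictScalars F ρ).asModule :=
    Module.Finite.of_restrictScalars_finite F _ _
  obtain ⟨n, ⟨e⟩⟩ := hiso.linearEquiv_fun
  have hι : ∀ j : Fin n, ∃ k : W →ₗ[F] V, IsIntertwiningMap σ (restrictScalars F ρ) k ∧
      ∀ w : W, k w = e.symm (Pi.single j (w : σ.asModule)) := fun j =>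
    exists_isIntertwiningMap_of_asModule
      (e.symm.toLinearMap ∘ₗ LinearMap.single (MonoidAlgebra F G) (fun _ => σ.asModule) j)
  have hπ : ∀ j : Fin n, ∃ k : V →ₗ[F] W, IsIntertwiningMap (restrictScalars F ρ) σ k ∧
      ∀ v : V, k v = e (v : (restrictScalars F ρ).asModule) j := fun j =>
    exists_isIntertwiningMap_of_asModule (LinearMap.proj j ∘ₗ e.toLinearMap)
  choose ι hιi hι using hι
  choose π hπi hπ using hπ
  have hsum : ∀ v : V, ∑ j, ι j (π j v) = v := by
    intro v
    have h1 : ∑ j, Pi.single j (e (v : (restrictScalars F ρ).asModule) j) = e v :=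
      Finset.univ_sum_single _
    have h2 := (map_sum e.symm _ _).symm.trans (congrArg e.symm h1)
    refine (Finset.sum_congr rfl fun j _ => ?_).trans (h2.trans (e.symm_apply_apply _))
    exact (hι j _).trans (congrArg (fun w => e.symm (Pi.single j w)) (hπ j v))
  have hsum' : ∀ x : K ⊗[F] V, ∑ j, (ι j).liftBaseChange K ((π j).baseChange K x) =
      (LinearMap.id : V →ₗ[F] V).liftBaseChange K x := by
    intro x
    induction x using TensorProduct.induction_on with
    | zero => simp
    | tmul c v =>
      simp only [LinearMap.baseChange_tmul, LinearMap.liftBaseChange_tmul, ← Finset.smul_sum, hsum,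
        LinearMap.id_apply]
    | add x y hx hy => simp only [map_add, Finset.sum_add_distrib, hx, hy]
  have hlift : ∀ j, IsIntertwiningMap (GreenTheory.baseChange K σ) ρ
      ((ι j).liftBaseChange K) := by
    refine fun j => ⟨fun g x => ?_⟩
    induction x using TensorProduct.induction_on with
    | zero => simp
    | tmul c w =>
      rw [baseChange_apply_tmul, LinearMap.liftBaseChange_tmul, LinearMap.liftBaseChange_tmul,
        (hιi j).isIntertwining, map_smul]
      rfl
    | add x y hx hy => simp only [map_add, hx, hy]
  have := Algebra.FormallyUnramified.of_isSeparable F K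
  let s := Algebra.FormallyUnramified.sec F K V
  have hs : IsIntertwiningMap ρ (GreenTheory.baseChange K (restrictScalars F ρ)) s :=
    ⟨fun g v => sec_map (ρ g) v⟩
  have hs1 : ∀ v, (LinearMap.id : V →ₗ[F] V).liftBaseChange K (s v) = v := by
    intro v
    exact LinearMap.congr_fun (Algebra.FormallyUnramified.comp_sec F K V) v
  -- Splitting `V` into `K ⊗ V` and decomposing `V|_F` into copies of `W` writes the identity of `V`
  -- as a sum of maps through `K ⊗ W`. By locality one of them is bijective.
  have hid : ∑ j, (ι j).liftBaseChange K ∘ₗ ((π j).baseChange K ∘ₗ s) = LinearMap.id := by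
    ext v
    rw [LinearMap.sum_apply]
    exact (hsum' (s v)).trans (hs1 v)
  have hπs : ∀ j, IsIntertwiningMap ρ (GreenTheory.baseChange K σ) ((π j).baseChange K ∘ₗ s) :=
    fun j => ((hπi j).baseChange K).comp hs
  obtain ⟨j, -, hj⟩ := (isIndecomposable_of_isIrreducible hρ).exists_bijective_of_sum
    (s := Finset.univ) (f := fun j => (ι j).liftBaseChange K ∘ₗ ((π j).baseChange K ∘ₗ s))
    (fun j _ => (hlift j).comp (hπs j)) (by rw [hid]; exact Function.bijective_id)
  exact isSummand_iff.2 ⟨_, isRetract_of_bijective (hπs j) (hlift j) hj⟩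

end Separable

/-! ### Realization over a finite extension. -/

section Realize

variable {F L G M : Type*} [Field F] [Field L] [Algebra F L] [Group G]
  [AddCommGroup M] [Module L M]

/-- A module over an algebraic extension of `F` is defined over a finite extension of `F`. -/
lemma exists_intermediateField_baseChange_equiv [Finite G] [Algebra.IsAlgebraic F L]
    [FiniteDimensional L M] (ρ : Representation L G M) :
    ∃ (K : IntermediateField F L) (V : Submodule K M) (τ : Representation K G V),
      FiniteDimensional F K ∧ Nonempty ((baseChange L τ).Equiv ρ) := by
  let b := Module.finBasis L M
  -- All matrix entries of the action in the basis `b`: finitely many algebraic elements.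
  let S : Set L := Set.range fun x : G × Fin _ × Fin _ => b.repr (ρ x.1 (b x.2.1)) x.2.2
  have hS : S.Finite := Set.finite_range _
  let K := IntermediateField.adjoin F S
  have hK : FiniteDimensional F K := by
    have := hS.to_subtype
    exact IntermediateField.finiteDimensional_adjoin fun x _ =>
      Algebra.IsIntegral.isIntegral x
  let V : Submodule K M := Submodule.span K (Set.range b)
  have hV : ∀ g, V ≤ V.comap ((ρ g).restrictScalars K) := by
    intro g
    rw [Submodule.span_le]
    rintro _ ⟨j, rfl⟩
    change ρ g (b j) ∈ V
    rw [← b.sum_repr (ρ g (b j))]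
    refine Submodule.sum_mem _ fun i _ => ?_
    have hc : b.repr (ρ g (b j)) i ∈ K := IntermediateField.subset_adjoin F S ⟨(g, j, i), rfl⟩
    exact V.smul_mem (⟨_, hc⟩ : K) (Submodule.subset_span ⟨i, rfl⟩)
  let τ : Representation K G V :=
    { toFun := fun g => ((ρ g).restrictScalars K).restrict (hV g)
      map_one' := by ext; simp
      map_mul' := fun g h => by ext; simp }
  let c : Module.Basis _ K V := b.restrictScalars K
  let e : L ⊗[K] V ≃ₗ[L] M := (c.baseChange L).equiv b (Equiv.refl _)
  have he : (e : L ⊗[K] V →ₗ[L] M) = V.subtype.liftBaseChange L := by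
    refine (c.baseChange L).ext fun i => ?_
    rw [LinearEquiv.coe_coe, Module.Basis.equiv_apply, Module.Basis.baseChange_apply,
      LinearMap.liftBaseChange_tmul, one_smul]
    exact (Module.Basis.restrictScalars_apply K b i).symm
  refine ⟨K, V, τ, hK, ⟨Representation.Equiv.mk e fun g => ?_⟩⟩
  rw [he]
  ext v
  simp [baseChange_apply_tmul, τ]

/-- A simple module over an algebraic extension of a perfect field `F` descends to a direct summand
of `K ⊗ σ`, where `σ` is its simple constituent over `F` and `K` a finite extension of `F`. -/
lemma Occurs.exists_isSummand_baseChange [Finite G] [Algebra.IsAlgebraic F L] [PerfectField F]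
    {W : Type*} [AddCommGroup W] [Module F W] {σ : Representation F G W}
    {ρ : Representation L G M} (hρ : ρ.IsIrreducible) (hσ : σ.IsIrreducible) (h : Occurs σ ρ) :
    ∃ (K : IntermediateField F L) (V : Submodule K M) (τ : Representation K G V),
      FiniteDimensional F K ∧ τ.IsIrreducible ∧ IsSummand τ (GreenTheory.baseChange K σ) ∧
      Nonempty ((GreenTheory.baseChange L τ).Equiv ρ) := by
  have := finiteDimensional_of_isIrreducible hρ
  obtain ⟨K, V, τ, hK, ⟨e⟩⟩ := exists_intermediateField_baseChange_equiv (F := F) ρ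
  have hτ : τ.IsIrreducible := isIrreducible_of_baseChange (isIrreducible_of_equiv hρ e.symm)
  refine ⟨K, V, τ, hK, hτ, ?_, ⟨e⟩⟩
  have := nontrivial_of_isIrreducible hτ
  let _ : Module F V := Module.compHom V (algebraMap F K)
  have : IsScalarTower F K V := IsScalarTower.of_algebraMap_smul fun _ _ => rfl
  -- A constituent of `τ` over `F` also occurs in `ρ`, so uniqueness identifies it with `σ`.
  obtain ⟨A, hA, hAτ⟩ := exists_isIrreducible_occurs F τ
  have hAρ : Occurs A.toRepresentation ρ :=
    (hAτ.baseChange (E := L)).comp (isRetract_of_equiv e).incl e.toLinearEquiv.injective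
  obtain ⟨e'⟩ := Occurs.unique hρ hA hσ hAρ h
  exact (hAτ.of_equiv e').isSummand hτ hσ

end Realize

/-! ### Relative projectivity under change of field. -/

section Descent

variable {K : Type*} [Field K] {L : Type*} [Field L] [Algebra K L] {G : Type*} [Group G]
  [Finite G] {V T M : Type*} [AddCommGroup V] [Module K V] [AddCommGroup T] [Module K T]
  [AddCommGroup M] [Module L M] {τ : Representation K G V} {ρ : Representation L G M}
  {P : Subgroup G}

/-- A `K`-linear retraction of `L` onto `K` makes `V` a summand of `L ⊗ V` viewed over `K`. -/
lemma isTraceProjective_of_baseChange (h : IsTraceProjective P (baseChange L τ)) :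
    IsTraceProjective P τ := by
  obtain ⟨φ, hφ⟩ := (Algebra.linearMap K L).exists_leftInverse_of_injective
    (LinearMap.ker_eq_bot.2 (algebraMap K L).injective)
  have h1 : φ 1 = 1 := by simpa using LinearMap.congr_fun hφ 1
  refine (h.restrictScalars K).of_isRetract (i := TensorProduct.mk K L V 1)
    (p := (TensorProduct.lid K V).toLinearMap ∘ₗ φ.rTensor V)
    ⟨⟨fun g v => rfl⟩, ⟨fun g x => ?_⟩, LinearMap.ext fun v => by simp [h1]⟩
  rw [restrictScalars_apply]
  induction x using TensorProduct.induction_on with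
  | zero => simp
  | tmul c v => simp [baseChange_apply_tmul]
  | add x y hx hy => simp only [map_add, hx, hy]

lemma isTraceProjective_iff_of_equiv (e : (baseChange L τ).Equiv ρ) :
    IsTraceProjective P ρ ↔ IsTraceProjective P τ :=
  ⟨fun h => isTraceProjective_of_baseChange (h.of_isRetract (isRetract_of_equiv e)),
    fun h => (h.baseChange L).of_isRetract (isRetract_of_equiv e.symm)⟩

/-- `ρ` is a summand of `L ⊗ σ`, and conversely `σ` is a summand of `ρ` viewed over `K`, as that
module is semisimple and contains `σ`. -/
lemma isTraceProjective_iff_of_isSummand {W : Type*} [AddCommGroup W] [Module K W]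
    {σ : Representation K G W} (hρ : ρ.IsIrreducible) (hσ : σ.IsIrreducible)
    (h : IsSummand ρ (baseChange L σ)) : IsTraceProjective P ρ ↔ IsTraceProjective P σ := by
  let _ : Module K M := Module.compHom M (algebraMap K L)
  have : IsScalarTower K L M := IsScalarTower.of_algebraMap_smul fun _ _ => rfl
  have := nontrivial_of_isIrreducible hρ
  obtain ⟨i, p, hr⟩ := isSummand_iff.1 h
  obtain ⟨j, q, hq⟩ := exists_isRetract_restrictScalars hρ hσ (occurs_of_isSummand h)
  exact ⟨fun h => (h.restrictScalars K).of_isRetract hq, fun h => (h.baseChange L).of_isRetract hr⟩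

/-- If `τ` is a direct summand of the module induced from `π`, then the same is true after an
extension of scalars. -/
lemma exists_relTr_eq_id_of_equiv (e : (baseChange L τ).Equiv ρ) {π : Representation K P T}
    {a : V →ₗ[K] T} {b : T →ₗ[K] V} (ha : IsIntertwiningMap (res P τ) π a)
    (hb : IsIntertwiningMap π (res P τ) b) (h1 : relTr τ τ P (b ∘ₗ a) = LinearMap.id) :
    ∃ (a' : M →ₗ[L] L ⊗[K] T) (b' : L ⊗[K] T →ₗ[L] M),
      IsIntertwiningMap (res P ρ) (baseChange L π) a' ∧
      IsIntertwiningMap (baseChange L π) (res P ρ) b' ∧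
      relTr ρ ρ P (b' ∘ₗ a') = LinearMap.id := by
  have hr := isRetract_of_equiv e.symm
  refine ⟨a.baseChange L ∘ₗ e.symm.toLinearMap, e.symm.symm.toLinearMap ∘ₗ b.baseChange L,
    (ha.baseChange L).comp (hr.incl.res P), (hr.proj.res P).comp (hb.baseChange L), ?_⟩
  rw [LinearMap.comp_assoc, ← LinearMap.comp_assoc e.symm.toLinearMap, ← LinearMap.baseChange_comp,
    ← comp_relTr hr.proj, ← relTr_comp hr.incl, relTr_baseChange, h1, LinearMap.baseChange_id,
    LinearMap.id_comp, hr.proj_incl]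

end Descent

/-! ### Finiteness of the set of simple types. -/

section Types

/-- A simple module embeds in the regular module and its type is determined by its isotypic
component there. The regular module is Noetherian, so these components are finite in number. -/
lemma finite_ITS (K : Type u) [Field K] (G : Type v) [Group G] [Finite G] :
    Finite (ITS.{u, v, w} K G) := by
  let R := (leftRegular K G).asModule
  have : Module.Finite K R := inferInstanceAs (Module.Finite K (MonoidAlgebra K G))
  have : IsNoetherian K R := inferInstance
  have : IsNoetherian (MonoidAlgebra K G) R := isNoetherian_of_tower K inferInstance
  have hX : ∀ X : SimpleMod.{u, v, w} K G, ∃ S : Submodule (MonoidAlgebra K G) R,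
      Nonempty (S ≃ₗ[MonoidAlgebra K G] X.1.ρ.asModule) := by
    intro X
    obtain ⟨f, hf, hi⟩ := exists_injective_leftRegular K G X.2
    exact ⟨_, ⟨(LinearEquiv.ofInjective (toAsModule hf) hi).symm⟩⟩
  choose S hS using hX
  have hsimple : ∀ X, IsSimpleModule (MonoidAlgebra K G) (S X) := fun X =>
    have := (irreducible_iff_isSimpleModule_asModule X.1.ρ).1 X.2
    IsSimpleModule.congr (hS X).some
  let c : ITS.{u, v, w} K G → isotypicComponents (MonoidAlgebra K G) R := fun q =>
    ⟨isotypicComponent (MonoidAlgebra K G) R (S q.out), S q.out, hsimple _, rfl⟩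
  refine Finite.of_injective c fun q q' h => ?_
  have h1 : S q.out ≤ isotypicComponent (MonoidAlgebra K G) R (S q'.out) :=
    (S q.out).le_isotypicComponent.trans_eq (congrArg Subtype.val h)
  have := hsimple q'.out
  obtain ⟨e⟩ := isIsotypicOfType_submodule_iff.1
    (IsIsotypicOfType.isotypicComponent (MonoidAlgebra K G) R (S q'.out)) _ h1
  rw [← q.out_eq, ← q'.out_eq]
  exact Quotient.sound (nonempty_equiv_of_asModule
    ((hS q.out).some.symm.trans (e.trans (hS q'.out).some)))

end Types

/-! ### Construction of the map on isomorphism types. -/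

section Main

variable {p : ℕ} [Fact p.Prime] {Fbar : Type u} [Field Fbar] [Algebra (ZMod p) Fbar]
  {G : Type v} [Group G] [Finite G]

/-- Occurrence is the field-independent form of the condition defining `Σ`. A finite extension of
the prime field is a finite field, so descent lands in `E`. -/
lemma occurs_iff_exists_mem_E [IsAlgClosure (ZMod p) Fbar] {X : Rep.{u} Fbar G}
    {W : Rep.{u} (ZMod p) G} (hX : X.ρ.IsIrreducible) (hW : W.ρ.IsIrreducible) :
    Occurs W.ρ X.ρ ↔ ∃ (K : IntermediateField (ZMod p) Fbar) (V : Rep.{u} K G),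
      (⟨K, V⟩ : Σ K : IntermediateField (ZMod p) Fbar, Rep.{u} K G) ∈ E Fbar W ∧
      Nonempty ((baseChange Fbar V.ρ).Equiv X.ρ) := by
  have : Algebra.IsAlgebraic (ZMod p) Fbar := IsAlgClosure.isAlgebraic
  constructor
  · intro h
    obtain ⟨K, V, τ, hK, hτ, hs, he⟩ := h.exists_isSummand_baseChange hX hW
    exact ⟨K, Rep.of τ, ⟨Module.finite_of_finite (ZMod p), isIndecomposable_of_isIrreducible hτ,
      hs⟩, he⟩
  · rintro ⟨K, V, ⟨-, hV, hs⟩, ⟨e⟩⟩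
    have := hV.2.1
    exact ((occurs_of_isSummand hs).baseChange (E := Fbar)).comp
      (isRetract_of_equiv e).incl e.toLinearEquiv.injective

lemma exists_simpleMod_occurs (W : SimpleMod.{0, v, u} (ZMod p) G) :
    ∃ X : SimpleMod.{u, v, u} Fbar G, Occurs W.1.ρ X.1.ρ := by
  have := nontrivial_of_isIrreducible W.2
  have := finiteDimensional_of_isIrreducible W.2
  obtain ⟨A, τ, hτ, hA⟩ := exists_isIrreducible_quotient (ρ := baseChange Fbar W.1.ρ)
  have := nontrivial_of_isIrreducible hτ
  refine ⟨⟨Rep.of τ, hτ⟩, A.mkQ, hA, fun h => ?_⟩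
  obtain ⟨x, hx⟩ := exists_ne (0 : (Fbar ⊗[ZMod p] W.1) ⧸ A)
  obtain ⟨y, rfl⟩ := A.mkQ_surjective x
  exact hx (LinearMap.congr_fun h y)

lemma exists_simpleMod_zmod_occurs (X : SimpleMod.{u, v, u} Fbar G) :
    ∃ W : SimpleMod.{0, v, u} (ZMod p) G, Occurs W.1.ρ X.1.ρ := by
  let _ : Module (ZMod p) X.1 := Module.compHom X.1 (algebraMap (ZMod p) Fbar)
  have : IsScalarTower (ZMod p) Fbar X.1 := IsScalarTower.of_algebraMap_smul fun _ _ => rfl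
  have := nontrivial_of_isIrreducible X.2
  obtain ⟨A, hA, h⟩ := exists_isIrreducible_occurs (ZMod p) X.1.ρ
  exact ⟨⟨Rep.of A.toRepresentation, hA⟩, h⟩

/-- The unique simple module over the prime field that occurs in a simple module over `Fbar`. -/
lemma exists_map_ITS : ∃ S : ITS.{u, v, u} Fbar G → ITS.{0, v, u} (ZMod p) G,
    ∀ X W, S (Quotient.mk _ X) = Quotient.mk _ W ↔ Occurs W.1.ρ X.1.ρ := by
  choose s hs using exists_simpleMod_zmod_occurs (p := p) (Fbar := Fbar) (G := G)
  refine ⟨Quotient.lift (fun X => Quotient.mk _ (s X)) ?_, fun X W => ?_⟩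
  · rintro X Y ⟨e⟩
    exact Quotient.sound (Occurs.unique Y.2 (s Y).2 (s X).2 (hs Y)
      ((hs X).comp (isRetract_of_equiv e).incl e.toLinearEquiv.injective))
  · rw [Quotient.lift_mk, Quotient.eq]
    constructor
    · rintro ⟨e⟩
      exact (hs X).of_equiv e.symm
    · exact fun h => Occurs.unique X.2 W.2 (s X).2 h (hs X)

end Main

end GreenTheory

theorem mainTheorem4 {p : ℕ} [Fact p.Prime]
    (Fbar : Type u) [Field Fbar] [Algebra (ZMod p) Fbar] [IsAlgClosure (ZMod p) Fbar]
    (G : Type v) [Group G] [Finite G] :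
    ∃ S : GreenTheory.ITS.{u, v, u} Fbar G → GreenTheory.ITS.{0, v, u} (ZMod p) G,
      -- `S` is the map (unique by this clause) given by descent to a finite field
      (∀ (X : GreenTheory.SimpleMod.{u, v, u} Fbar G)
          (W : GreenTheory.SimpleMod.{0, v, u} (ZMod p) G),
        S (Quotient.mk _ X) = Quotient.mk _ W ↔
          ∃ (K : IntermediateField (ZMod p) Fbar) (V : Rep.{u} K G),
            (⟨K, V⟩ : Σ K : IntermediateField (ZMod p) Fbar, Rep.{u} K G) ∈
              GreenTheory.E Fbar W.1 ∧
            Nonempty ((GreenTheory.baseChange Fbar V.ρ).Equiv X.1.ρ)) ∧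
      -- the modules `V` are simple; vertices, sources and Green correspondents are compatible
      (∀ (X : GreenTheory.SimpleMod.{u, v, u} Fbar G)
          (W : GreenTheory.SimpleMod.{0, v, u} (ZMod p) G)
          (K : IntermediateField (ZMod p) Fbar) (V : Rep.{u} K G),
        (⟨K, V⟩ : Σ K : IntermediateField (ZMod p) Fbar, Rep.{u} K G) ∈
            GreenTheory.E Fbar W.1 →
        Nonempty ((GreenTheory.baseChange Fbar V.ρ).Equiv X.1.ρ) →
          V.ρ.IsIrreducible ∧
          ∀ Q : Subgroup G, GreenTheory.IsVertex Q W.1.ρ →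
            GreenTheory.IsVertex Q V.ρ ∧
            GreenTheory.IsVertex Q X.1.ρ ∧
            (∀ (sV : Rep.{u} K Q) (sX : Rep.{u} Fbar Q),
              GreenTheory.IsVertexSource Q sV.ρ V.ρ →
              GreenTheory.IsVertexSource Q sX.ρ X.1.ρ →
                ∃ h : GreenTheory.normalizer Q,
                  GreenTheory.IsSummand (GreenTheory.conj h sX.ρ)
                    (GreenTheory.baseChange Fbar sV.ρ)) ∧
            (∃ gV : Rep.{u} K (GreenTheory.normalizer Q),
              GreenTheory.IsGreenCorrespondent Q gV.ρ V.ρ) ∧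
            (∃ gX : Rep.{u} Fbar (GreenTheory.normalizer Q),
              GreenTheory.IsGreenCorrespondent Q gX.ρ X.1.ρ) ∧
            (∀ (gV : Rep.{u} K (GreenTheory.normalizer Q)) (gX : Rep.{u} Fbar (GreenTheory.normalizer Q)),
              GreenTheory.IsGreenCorrespondent Q gV.ρ V.ρ →
              GreenTheory.IsGreenCorrespondent Q gX.ρ X.1.ρ →
                GreenTheory.IsSummand gX.ρ (GreenTheory.baseChange Fbar gV.ρ))) ∧
      -- the fibers are nonempty and partition the simple modules
      (∀ W, (S ⁻¹' {W}).Nonempty) ∧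
      (⋃ W, S ⁻¹' {W}) = Set.univ ∧
      (Pairwise fun W W' => Disjoint (S ⁻¹' {W}) (S ⁻¹' {W'})) ∧
      -- the counting formula
      Finite (GreenTheory.ITS.{u, v, u} Fbar G) ∧
      Finite (GreenTheory.ITS.{0, v, u} (ZMod p) G) ∧
      Nat.card (GreenTheory.ITS.{u, v, u} Fbar G) = ∑ᶠ W, Nat.card (S ⁻¹' {W}) := by
  open GreenTheory in
  obtain ⟨S, hS⟩ := exists_map_ITS (p := p) (Fbar := Fbar) (G := G)
  have hfin := finite_ITS.{u, v, u} Fbar G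
  have hfin' := finite_ITS.{0, v, u} (ZMod p) G
  refine ⟨S, fun X W => (hS X W).trans (occurs_iff_exists_mem_E X.2 W.2), ?_, fun W => ?_, ?_,
    fun W W' h => ?_, hfin, hfin', ?_⟩
  · rintro X W K V ⟨-, -, hs⟩ ⟨e⟩
    have hV : V.ρ.IsIrreducible := isIrreducible_of_baseChange (isIrreducible_of_equiv X.2 e.symm)
    refine ⟨hV, fun Q hQ => ?_⟩
    -- `W` and `V`, and below `V` and `X`, are projective relative to the same subgroups, so the
    -- minimal ones agree.
    have hQV : IsVertex Q V.ρ := by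
      rw [isVertex_iff] at hQ ⊢
      simp only [isTraceProjective_iff_of_isSummand hV W.2 hs]
      exact ⟨isIndecomposable_of_isIrreducible hV, hQ.2⟩
    have hQX : IsVertex Q X.1.ρ := by
      rw [isVertex_iff] at hQV ⊢
      simp only [isTraceProjective_iff_of_equiv e]
      exact ⟨isIndecomposable_of_isIrreducible X.2, hQV.2⟩
    refine ⟨hQV, hQX, fun sV sX hsV hsX => ?_, ?_, ?_, fun gV gX hgV hgX => ?_⟩
    · obtain ⟨a, b, ha, hb, h1⟩ := isSummand_ind_iff.1 hsV.2.2
      -- After extension of scalars, `X` is a summand of the module induced from `Fbar ⊗ sV`, whose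
      -- restriction to indecomposable summands is not needed: a conjugate of any source of `X`
      -- splits off it.
      obtain ⟨a', b', ha', hb', h1'⟩ := exists_relTr_eq_id_of_equiv e ha hb h1
      exact hsX.exists_isSummand_conj ha' hb' h1'
    · obtain ⟨A, hA⟩ := hQV.exists_isGreenCorrespondent
      exact ⟨Rep.of A.toRepresentation, hA⟩
    · obtain ⟨A, hA⟩ := hQX.exists_isGreenCorrespondent
      exact ⟨Rep.of A.toRepresentation, hA⟩
    · obtain ⟨a, b, ha, hb, h1⟩ := hgV.exists_relTr_eq
      obtain ⟨a', b', ha', hb', h1'⟩ := exists_relTr_eq_id_of_equiv e ha hb h1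
      -- `Fbar ⊗ gV` need not be indecomposable; it only has to be `Q`-projective and to induce to a
      -- module having `X` as a summand.
      exact hgX.isSummand (hgV.2.1.isTraceProjective.baseChange Fbar) ha' hb' h1'
  · induction W using Quotient.inductionOn with
    | h W =>
      obtain ⟨X, hX⟩ := exists_simpleMod_occurs (Fbar := Fbar) W
      exact ⟨Quotient.mk _ X, (hS X W).2 hX⟩
  · exact Set.eq_univ_of_forall fun X => Set.mem_iUnion.2 ⟨S X, rfl⟩
  · exact Set.disjoint_left.2 fun X hX hX' => h (hX.symm.trans hX')
  · let _ := Fintype.ofFinite (ITS.{0, v, u} (ZMod p) G)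
    rw [finsum_eq_sum_of_fintype, ← Nat.card_sigma]
    exact Nat.card_congr (Equiv.sigmaFiberEquiv S).symm
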